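/- **Theorem 2.4 (Nicholson-type formula).** For an integer $\alpha\ge 0$ let $$j_\alpha(x)=2^\alpha\Gamma(\alpha+1)\frac{J_\alpha(x)}{x^\alpha},\qquad y_\alpha(x)=2^\alpha\Gamma(\alpha+1)\frac{Y_\alpha(x)}{x^\alpha}$$ be the normalized Bessel functions of the first and second kind, where $J_\nu(x)=(x/2)^\nu\sum_{n\ge0}\frac{(-1)^n(x/2)^{2n}}{n!\,\Gamma(n+\nu+1)}$ and $Y_\alpha(x)=\frac1\pi\left[\partial_\nu J_\nu(x)-(-1)^\alpha\partial_\nu J_{-\nu}(x)\right]_{\nu=\alpha}$, with principal branches on the slit plane $\mathbb C\setminus(-\infty,0]$; $j_\alpha$ is extended to an entire even function with $j_\alpha(0)=1$. Write $D_s=\frac1s\frac{d}{ds}$. For every integer $\alpha\ge0$ there is a nonzero constant $C(\alpha)$, depending only on $\alpha$, such that the following holds for all complex $z\ne w$ with $z,w\in\mathbb C\setminus(-\infty,0]$. Put $$f(s)=\frac{\alpha}{2^{2\alpha-2}}\,\frac{R(s)^{2\alpha-1}}{z^{2\alpha}w^{2\alpha}},$$ where $s$ is real and near $0$ and $R$ is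 any continuous branch, near $s=0$, of the square root $$\pm\left\{(z^2-w^2)^2-2s^2(z^2+w^2)+s^4\right\}^{1/2}\quad\text{with}\quad R(0)=z^2-w^2.$$ (For $z,w>0$ this means that $R(s)$ is $\operatorname{sgn}(|z|-|w|)$ times the positive square root, so that $f(s)=\frac{\alpha\,\operatorname{sgn}(|z|-|w|)}{2^{2\alpha-2}}\frac{\{(z^2-w^2)^2-2s^2(z^2+w^2)+s^4\}^{(2\alpha-1)/2}}{z^{2\alpha}w^{2\alpha}}$.) Let $a_0=1$ and $a_j=2(\alpha-j)a_{j-1}$. Then for $0\le j<\alpha$ the limit $D_s^jf(0):=\lim_{s\to0}D_s^jf(s)$ exists, and for every piecewise $C^1$ contour $\mathcal C$ from $0$ to $\ln z-\ln w$ (principal logarithms) $$\int_{\mathcal C} j_\alpha\!\left(\sqrt{z^2+w^2-2zw\cosh\zeta}\right)\sinh^{2\alpha}\zeta\,d\zeta-\sum_{j=0}^{\alpha-1}a_j\,D_s^jf(0)=C(\alpha)\left(j_\alpha(z)y_\alpha(w)-y_\alpha(z)j_\alpha(w)\right).$$ For $\alpha=0$ the sum is empty and contributes zero. -/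

import Mathlib

open Filter Set
open scoped Topology

noncomputable section

namespace Nicholson

/-- The even power series `∑ₙ (-1)ⁿ (x/2)²ⁿ / (n! Γ(n + ν + 1))`, an entire function of `x` and
of `ν`. At the poles of `Γ` Mathlib has `Γ = 0`, so that the term `1 / Γ` is `0`, as it should
be. -/
def besselSeries (ν x : ℂ) : ℂ :=
  ∑' n : ℕ, (-1) ^ n * (x / 2) ^ (2 * n) / ((n.factorial : ℂ) * Complex.Gamma (n + ν + 1))

/-- The Bessel function of the first kind `J_ν(x)`, with the principal branch of the power. -/
def besselJ (ν x : ℂ) : ℂ :=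
  (x / 2) ^ ν * besselSeries ν x

/-- The Bessel function of the second kind `Y_n(x)` of integer order:
`(1/π) [∂J_ν(x)/∂ν - (-1)ⁿ ∂J_{-ν}(x)/∂ν]` at `ν = n`. -/
def besselY (n : ℕ) (x : ℂ) : ℂ :=
  1 / (Real.pi : ℂ) *
    (deriv (fun ν : ℂ => besselJ ν x) n - (-1) ^ n * deriv (fun ν : ℂ => besselJ (-ν) x) n)

/-- The normalized Bessel function of the first kind, `j_α(x) = 2^α Γ(α+1) J_α(x) / x^α`, written
as the entire even function that this quotient extends to (`j_α(0) = 1`); see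
`normBesselJ_eq`. -/
def normBesselJ (α : ℕ) (x : ℂ) : ℂ :=
  Complex.Gamma (α + 1) * besselSeries α x

/-- The normalized Bessel function of the second kind, `y_α(x) = 2^α Γ(α+1) Y_α(x) / x^α`. -/
def normBesselY (α : ℕ) (x : ℂ) : ℂ :=
  2 ^ α * Complex.Gamma (α + 1) * (besselY α x / x ^ α)

theorem normBesselJ_eq (α : ℕ) {x : ℂ} (hx : x ≠ 0) :
    normBesselJ α x = 2 ^ α * Complex.Gamma (α + 1) * (besselJ α x / x ^ α) := by
  have h2 : (2 : ℂ) ^ α ≠ 0 := pow_ne_zero _ two_ne_zero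
  have hxα : x ^ α ≠ 0 := pow_ne_zero _ hx
  simp only [normBesselJ, besselJ, Complex.cpow_natCast, div_pow]
  field_simp

/-- The path `γ` is piecewise continuously differentiable. -/
def IsPiecewiseC1 {a b : ℂ} (γ : Path a b) : Prop :=
  ∃ (n : ℕ) (t : ℕ → ℝ), Monotone t ∧ t 0 = 0 ∧ t n = 1 ∧
    ∀ i < n, ContDiffOn ℝ 1 γ.extend (Icc (t i) (t (i + 1)))

/-- The contour integral `∫_γ F(ζ) dζ`. -/
def contourIntegral (F : ℂ → ℂ) {a b : ℂ} (γ : Path a b) : ℂ :=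
  ∫ᶜ ζ in γ, F ζ • ContinuousLinearMap.id ℂ ℂ

/-- The integrand `j_α(√(z² + w² - 2zw cosh ζ)) sinh^{2α} ζ`; as `j_α` is even, the choice of the
square root does not matter. -/
def integrand (α : ℕ) (z w ζ : ℂ) : ℂ :=
  normBesselJ α (Complex.sqrt (z ^ 2 + w ^ 2 - 2 * z * w * Complex.cosh ζ)) *
    Complex.sinh ζ ^ (2 * α)

/-- `Q(s) = (z² - w²)² - 2s²(z² + w²) + s⁴`. -/
def quartic (z w : ℂ) (s : ℝ) : ℂ :=
  (z ^ 2 - w ^ 2) ^ 2 - 2 * (s : ℂ) ^ 2 * (z ^ 2 + w ^ 2) + (s : ℂ) ^ 4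

/-- `R` is, near `s = 0`, the continuous branch of the square root `± Q(s)^{1/2}` with the value
`z² - w²` at `s = 0`. For positive `z ≠ w` this is `sgn(|z| - |w|)` times the positive root of
`Q(s)`; see `isSignedRoot_of_pos`. -/
structure IsSignedRoot (z w : ℂ) (R : ℝ → ℂ) : Prop where
  continuousAt : ∀ᶠ s in 𝓝 (0 : ℝ), ContinuousAt R s
  sq_eq : ∀ᶠ s in 𝓝 (0 : ℝ), R s ^ 2 = quartic z w s
  map_zero : R 0 = z ^ 2 - w ^ 2

theorem isSignedRoot_of_pos {x y : ℝ} (hx : 0 < x) (hy : 0 < y) (hxy : x ≠ y) :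
    IsSignedRoot x y fun s =>
      ((Real.sign (|x| - |y|) *
        √((x ^ 2 - y ^ 2) ^ 2 - 2 * s ^ 2 * (x ^ 2 + y ^ 2) + s ^ 4) : ℝ) : ℂ) := by
  have h0 : 0 < (x ^ 2 - y ^ 2) ^ 2 := by
    have : x ^ 2 - y ^ 2 ≠ 0 := by
      rw [sq_sub_sq]
      exact mul_ne_zero (by positivity) (sub_ne_zero.2 hxy)
    positivity
  have hpos : ∀ᶠ s in 𝓝 (0 : ℝ),
      0 < (x ^ 2 - y ^ 2) ^ 2 - 2 * s ^ 2 * (x ^ 2 + y ^ 2) + s ^ 4 := by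
    have hc : Continuous fun s : ℝ =>
        (x ^ 2 - y ^ 2) ^ 2 - 2 * s ^ 2 * (x ^ 2 + y ^ 2) + s ^ 4 := by fun_prop
    exact hc.continuousAt.eventually (lt_mem_nhds (by simpa using h0))
  refine ⟨Eventually.of_forall fun s => by fun_prop, ?_, ?_⟩
  · filter_upwards [hpos] with s hs
    have hsign : Real.sign (|x| - |y|) ^ 2 = 1 := by
      rw [abs_of_pos hx, abs_of_pos hy]
      rcases lt_or_gt_of_ne hxy with h | h
      · rw [Real.sign_of_neg (by linarith)]; norm_num
      · rw [Real.sign_of_pos (by linarith)]; norm_num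
    rw [← Complex.ofReal_pow, mul_pow, hsign, Real.sq_sqrt hs.le]
    simp [quartic]
  · simp only [abs_of_pos hx, abs_of_pos hy]
    rcases lt_or_gt_of_ne hxy with h | h
    · rw [Real.sign_of_neg (by linarith)]
      have : √((x ^ 2 - y ^ 2) ^ 2 - 2 * 0 ^ 2 * (x ^ 2 + y ^ 2) + 0 ^ 4) = y ^ 2 - x ^ 2 := by
        rw [show (x ^ 2 - y ^ 2) ^ 2 - 2 * 0 ^ 2 * (x ^ 2 + y ^ 2) + 0 ^ 4 = (y ^ 2 - x ^ 2) ^ 2 by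
          ring]
        exact Real.sqrt_sq (by nlinarith)
      rw [this]; push_cast; ring
    · rw [Real.sign_of_pos (by linarith)]
      have : √((x ^ 2 - y ^ 2) ^ 2 - 2 * 0 ^ 2 * (x ^ 2 + y ^ 2) + 0 ^ 4) = x ^ 2 - y ^ 2 := by
        rw [show (x ^ 2 - y ^ 2) ^ 2 - 2 * 0 ^ 2 * (x ^ 2 + y ^ 2) + 0 ^ 4 = (x ^ 2 - y ^ 2) ^ 2 by
          ring]
        exact Real.sqrt_sq (by nlinarith)
      rw [this]; push_cast; ring

/-- The branch exists for all `z ≠ w` with `z ≠ 0`. -/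
theorem exists_isSignedRoot {z w : ℂ} (hz : z ≠ 0) (hzw : z ≠ w) :
    ∃ R : ℝ → ℂ, IsSignedRoot z w R := by
  by_cases h : z ^ 2 - w ^ 2 = 0
  · have hw : w = -z := by
      rw [sq_sub_sq, mul_eq_zero] at h
      rcases h with h | h
      · exact eq_neg_of_add_eq_zero_right h
      · exact absurd (sub_eq_zero.1 h) hzw
    subst hw
    have hc : ∀ᶠ s : ℝ in 𝓝 (0 : ℝ), (1 - (s : ℂ) ^ 2 / (4 * z ^ 2)) ∈ Complex.slitPlane := by
      have : Continuous fun s : ℝ => 1 - (s : ℂ) ^ 2 / (4 * z ^ 2) := by fun_prop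
      exact this.continuousAt.eventually_mem (Complex.isOpen_slitPlane.mem_nhds (by simp))
    refine ⟨fun s => (s : ℂ) * (2 * Complex.I * z) *
      (1 - (s : ℂ) ^ 2 / (4 * z ^ 2)) ^ (1 / 2 : ℂ), ?_, ?_, by simp⟩
    · filter_upwards [hc] with s hs
      refine ContinuousAt.mul (by fun_prop) (ContinuousAt.cpow ?_ (by fun_prop) hs)
      fun_prop
    · refine Eventually.of_forall fun s => ?_
      have : ((1 - (s : ℂ) ^ 2 / (4 * z ^ 2)) ^ (1 / 2 : ℂ)) ^ 2 =
          1 - (s : ℂ) ^ 2 / (4 * z ^ 2) := by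
        rw [← Complex.cpow_mul_nat]; norm_num
      rw [mul_pow, this, quartic]
      have hI : Complex.I ^ 2 = -1 := Complex.I_sq
      field_simp
      rw [hI]
      ring
  · have hc : ∀ᶠ s in 𝓝 (0 : ℝ),
        quartic z w s / (z ^ 2 - w ^ 2) ^ 2 ∈ Complex.slitPlane := by
      have : Continuous fun s : ℝ => quartic z w s / (z ^ 2 - w ^ 2) ^ 2 := by
        unfold quartic
        fun_prop
      exact this.continuousAt.eventually_mem (Complex.isOpen_slitPlane.mem_nhds (by
        simp [quartic, h]))
    refine ⟨fun s => (z ^ 2 - w ^ 2) *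
      (quartic z w s / (z ^ 2 - w ^ 2) ^ 2) ^ (1 / 2 : ℂ), ?_, ?_, by simp [quartic, h]⟩
    · filter_upwards [hc] with s hs
      refine ContinuousAt.mul (by fun_prop) (ContinuousAt.cpow ?_ (by fun_prop) hs)
      unfold quartic; fun_prop
    · refine Eventually.of_forall fun s => ?_
      have : ((quartic z w s / (z ^ 2 - w ^ 2) ^ 2) ^ (1 / 2 : ℂ)) ^ 2 =
          quartic z w s / (z ^ 2 - w ^ 2) ^ 2 := by
        rw [← Complex.cpow_mul_nat]; norm_num
      rw [mul_pow, this]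
      field_simp

/-- `f(s) = (α / 2^{2α-2}) {sgn · Q(s)^{1/2}}^{2α-1} / (z^{2α} w^{2α})`, where `R` stands for the
signed root `sgn · Q^{1/2}` (as `2α - 1` is odd, the sign may be drawn into the power). -/
def corrFun (α : ℕ) (z w : ℂ) (R : ℝ → ℂ) (s : ℝ) : ℂ :=
  (α : ℂ) / 2 ^ (2 * (α : ℤ) - 2) * (R s ^ (2 * (α : ℤ) - 1) / (z ^ (2 * α) * w ^ (2 * α)))

/-- The operator `D_s = (1/s) d/ds`. -/
def opD (g : ℝ → ℂ) : ℝ → ℂ := fun s => 1 / (s : ℂ) * deriv g s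

/-- `D_s^j g(0)`, the limit of `D_s^j g(s)` as `s → 0`, `s ≠ 0`. -/
def opDAtZero (j : ℕ) (g : ℝ → ℂ) : ℂ := limUnder (𝓝[≠] (0 : ℝ)) (opD^[j] g)

/-- `a_0 = 1`, `a_j = 2(α - j) a_{j-1}`. -/
def coeffA (α : ℕ) : ℕ → ℂ
  | 0 => 1
  | j + 1 => 2 * ((α : ℂ) - ((j : ℂ) + 1)) * coeffA α j

end Nicholson

end

noncomputable section

namespace Nicholson

/-! Fix `w` and regard the left-hand side as a function `F` of `z` on the slit plane. It turns out
to solve the Bessel equation `u'' + (2α+1)/z u' + u = 0` and to vanish at `z = w`. The solutions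
vanishing at `w` are the multiples of `j_α(z) y_α(w) - y_α(z) j_α(w)`, and Wronskians identify the
factor (`eq_of_solvesBesselAt`).

The integrand is entire, so the contour may be replaced by the segment from `0` to `ln z - ln w`. Up
to the factor `z²`, the Bessel operator in `z` turns the integrand into an exact `ζ`-derivative
(`hasDerivAt_kernelFlux`). Hence the integral satisfies an inhomogeneous Bessel equation whose
right-hand side consists of endpoint terms. At the moving endpoint the argument of `j_α` is zero, so
these terms are elementary: a constant times `(z² - w²)^(2α-1) / (zw)^(2α)`
(`hasDerivAt_nicholsonIntegral'`).

The correction terms solve the same inhomogeneous equation. Let `T_j` be `D_s^j f(0)` as a function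
of `z`. Then `T_j'' + (2α+1)/z T_j' = -2(α-1-j) T_{j+1}` (`hasDerivAt_corrTerm'`). With `a_{j+1} =
2(α-1-j) a_j` the sum `∑ a_j T_j` telescopes under the Bessel operator and leaves `T_0 = f(0)`
(`corrSum_ode`).

The constant is `-w^(2α+1) F'(w)` divided by the normalized Wronskian of `j_α` and `y_α`. The
numerator is a nonzero number independent of `w`: for `α = 0` it comes from the integral, for `α ≥
1` from the last correction term alone (`deriv_nicholsonDiff_self`). The Wronskian is constant, and
its limit at `0` shows that it is nonzero (`wronskian_normBessel_ne_zero`). -/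

/-! ### Entire series `∑ₙ cₙ (-S/4)ⁿ / n!` with bounded coefficients -/

/-- The series `∑ₙ cₙ (-S/4)ⁿ / n!`. -/
def expSeries (c : ℕ → ℂ) (S : ℂ) : ℂ :=
  ∑' n : ℕ, c n * ((-S / 4) ^ n / (n.factorial : ℂ))

/-- The coefficient sequence is bounded. -/
def BoundedCoeff (c : ℕ → ℂ) : Prop := ∃ M : ℝ, ∀ n, ‖c n‖ ≤ M

theorem BoundedCoeff.shift {c : ℕ → ℂ} (hc : BoundedCoeff c) :
    BoundedCoeff fun n => c (n + 1) :=
  hc.imp fun _ h n => h (n + 1)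

theorem summable_norm_expSeries {c : ℕ → ℂ} (hc : BoundedCoeff c) (S : ℂ) :
    Summable fun n : ℕ => ‖c n * ((-S / 4) ^ n / (n.factorial : ℂ))‖ := by
  obtain ⟨M, hM⟩ := hc
  refine Summable.of_nonneg_of_le (fun n => norm_nonneg _) (fun n => ?_)
    ((Real.summable_pow_div_factorial (‖-S / 4‖)).mul_left M)
  rw [norm_mul, norm_div, norm_pow, Complex.norm_natCast]
  gcongr
  exact hM n

theorem hasSum_expSeries {c : ℕ → ℂ} (hc : BoundedCoeff c) (S : ℂ) :
    HasSum (fun n : ℕ => c n * ((-S / 4) ^ n / (n.factorial : ℂ))) (expSeries c S) :=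
  (summable_norm_expSeries hc S).of_norm.hasSum

theorem expSeries_zero (c : ℕ → ℂ) : expSeries c 0 = c 0 := by
  rw [expSeries, tsum_eq_single 0]
  · simp
  · intro n hn
    simp [hn]

/-- Differentiation only shifts the coefficients, so a second-order equation for the series becomes
a recurrence for `c`. Bounded coefficients allow termwise differentiation on any ball. -/
theorem hasDerivAt_expSeries {c : ℕ → ℂ} (hc : BoundedCoeff c) (S : ℂ) :
    HasDerivAt (expSeries c) (-(1 / 4) * expSeries (fun n => c (n + 1)) S) S := by
  set F : ℕ → ℂ → ℂ := fun n S => c n * ((-S / 4) ^ n / (n.factorial : ℂ)) with hF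
  obtain ⟨M, hM⟩ := id hc
  set r : ℝ := ‖S‖ + 1
  have hu : Summable fun n : ℕ => M * ((r / 4) ^ n / (n.factorial : ℝ)) :=
    (Real.summable_pow_div_factorial _).mul_left M
  have hdiff : ∀ n, DifferentiableOn ℂ (F n) (Metric.ball 0 r) := fun n => by
    simp only [hF]; fun_prop
  have hbound : ∀ n x, x ∈ Metric.ball (0 : ℂ) r → ‖F n x‖ ≤
      M * ((r / 4) ^ n / (n.factorial : ℝ)) := by
    intro n x hx
    have hx' : ‖x‖ ≤ r := by simpa using (mem_ball_zero_iff.1 hx).le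
    simp only [hF, norm_mul, norm_div, norm_pow, Complex.norm_natCast, norm_neg]
    have h4 : ‖(4 : ℂ)‖ = 4 := by norm_num
    rw [h4]
    have hM0 : 0 ≤ M := (norm_nonneg _).trans (hM 0)
    gcongr
    exact hM n
  have hS : S ∈ Metric.ball (0 : ℂ) r := by simp [r]
  have hderiv := Complex.hasSum_deriv_of_summable_norm hu hdiff Metric.isOpen_ball hbound hS
  have hFd : ∀ n, HasDerivAt (F n)
      (c n * ((n : ℂ) * (-S / 4) ^ (n - 1) * (-1 / 4) / (n.factorial : ℂ))) S := by
    intro n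
    have h1 : HasDerivAt (fun S : ℂ => -S / 4) (-1 / 4) S := (hasDerivAt_id S).neg.div_const 4
    exact ((h1.pow n).div_const _).const_mul (c n)
  have hdo : DifferentiableOn ℂ (fun x => ∑' n, F n x) (Metric.ball 0 r) :=
    Complex.differentiableOn_tsum_of_summable_norm hu hdiff Metric.isOpen_ball hbound
  have hd : HasDerivAt (expSeries c) (deriv (fun x => ∑' n, F n x) S) S :=
    (hdo.differentiableAt (Metric.isOpen_ball.mem_nhds hS)).hasDerivAt
  convert hd using 1
  rw [← hderiv.tsum_eq, hderiv.summable.tsum_eq_zero_add, (hFd 0).deriv, expSeries,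
    ← tsum_mul_left]
  simp only [Nat.cast_zero, zero_mul, mul_zero, zero_add, zero_div]
  refine tsum_congr fun n => ?_
  rw [(hFd (n + 1)).deriv, Nat.factorial_succ]
  have : (n.factorial : ℂ) ≠ 0 := by exact_mod_cast n.factorial_ne_zero
  have h' : (n : ℂ) + 1 ≠ 0 := by exact_mod_cast n.succ_ne_zero
  simp only [Nat.add_sub_cancel]
  push_cast
  field_simp

/-- Multiplication by `S` acts on coefficients as `cₙ₊₁ ↦ n cₙ`. -/
theorem mul_expSeries_shift {c : ℕ → ℂ} (hc : BoundedCoeff c) (S : ℂ) :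
    S / 4 * expSeries (fun n => c (n + 1)) S = -expSeries (fun n => (n : ℂ) * c n) S := by
  have h2 : HasSum (fun n : ℕ => (n : ℂ) * c n * ((-S / 4) ^ n / (n.factorial : ℂ)))
      (-(S / 4) * expSeries (fun n => c (n + 1)) S) := by
    rw [← hasSum_nat_add_iff' 1]
    simp only [Finset.range_one, Finset.sum_singleton, Nat.cast_zero, zero_mul, sub_zero]
    convert! (hasSum_expSeries hc.shift S).mul_left (-(S / 4)) using 1
    ext n
    rw [Nat.factorial_succ]
    have : (n.factorial : ℂ) ≠ 0 := by exact_mod_cast n.factorial_ne_zero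
    have h' : (n : ℂ) + 1 ≠ 0 := by exact_mod_cast n.succ_ne_zero
    push_cast
    field_simp
    ring
  have h3 : expSeries (fun n => (n : ℂ) * c n) S = -(S / 4) * expSeries (fun n => c (n + 1)) S :=
    h2.tsum_eq
  rw [h3]
  ring

/-- The differential equation satisfied by `∑ₙ cₙ (-S/4)ⁿ / n!` when
`cₙ = (n + ν + 1) cₙ₊₁ + eₙ`. -/
theorem expSeries_ode {c e : ℕ → ℂ} (hc : BoundedCoeff c) (he : BoundedCoeff e) {ν : ℂ}
    (h : ∀ n : ℕ, c n = (n + ν + 1) * c (n + 1) + e n) (S : ℂ) :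
    S / 4 * expSeries (fun n => c (n + 2)) S - (ν + 1) * expSeries (fun n => c (n + 1)) S +
      expSeries c S = expSeries e S := by
  have h1 := mul_expSeries_shift hc.shift S
  have h2 : HasSum (fun n : ℕ => (n : ℂ) * c (n + 1) * ((-S / 4) ^ n / (n.factorial : ℂ)))
      (expSeries c S - (ν + 1) * expSeries (fun n => c (n + 1)) S - expSeries e S) := by
    convert! ((hasSum_expSeries hc S).sub ((hasSum_expSeries hc.shift S).mul_left (ν + 1))).sub
      (hasSum_expSeries he S) using 1
    ext n
    rw [h n]
    ring
  have h3 : expSeries (fun n => (n : ℂ) * c (n + 1)) S =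
      expSeries c S - (ν + 1) * expSeries (fun n => c (n + 1)) S - expSeries e S := h2.tsum_eq
  rw [h3] at h1
  linear_combination h1

/-! ### The reciprocal Gamma function -/

/-- The entire function `1 / Γ`. -/
def recipGamma (s : ℂ) : ℂ := (Complex.Gamma s)⁻¹

theorem recipGamma_eq (s : ℂ) : recipGamma s = s * recipGamma (s + 1) :=
  Complex.one_div_Gamma_eq_self_mul_one_div_Gamma_add_one s

theorem differentiable_recipGamma : Differentiable ℂ recipGamma :=
  Complex.differentiable_one_div_Gamma

theorem deriv_recipGamma_eq (s : ℂ) :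
    deriv recipGamma s = recipGamma (s + 1) + s * deriv recipGamma (s + 1) := by
  have h1 : HasDerivAt (fun s => s * recipGamma (s + 1))
      (1 * recipGamma (s + 1) + s * deriv recipGamma (s + 1)) s :=
    (hasDerivAt_id s).mul
      ((differentiable_recipGamma (s + 1)).hasDerivAt.comp_add_const s 1)
  rw [← funext recipGamma_eq, one_mul] at h1
  exact h1.deriv

theorem recipGamma_neg_nat (m : ℕ) : recipGamma (-m) = 0 := by
  simp [recipGamma, Complex.Gamma_neg_nat_eq_zero]

/-- The zeros of `1 / Γ` are simple. This is what makes the singular part of `y_α` at `0` nonzero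
when `α ≥ 1`. -/
theorem deriv_recipGamma_neg_nat_ne_zero (m : ℕ) : deriv recipGamma (-m) ≠ 0 := by
  induction m with
  | zero =>
    rw [deriv_recipGamma_eq]
    simp [recipGamma]
  | succ m ih =>
    have h : (-((m + 1 : ℕ) : ℂ)) + 1 = -m := by push_cast; ring
    rw [deriv_recipGamma_eq, h, recipGamma_neg_nat, zero_add]
    exact mul_ne_zero (neg_ne_zero.2 (Nat.cast_ne_zero.2 m.succ_ne_zero)) ih

/-- `1 / Γ(n + s)` is bounded uniformly in `n` and in `s` from a ball. -/
theorem exists_recipGamma_bound (r : ℝ) :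
    ∃ M : ℝ, ∀ (n : ℕ) (s : ℂ), ‖s‖ ≤ r → ‖recipGamma (n + s)‖ ≤ M := by
  -- Compactness bounds the terms with `n ≤ N`. Beyond `N` one has `|n + s| ≥ 1`, so `1/Γ(n+s) =
  -- (n+s)/Γ(n+s+1)` keeps the bound from growing.
  obtain ⟨N, hN⟩ := exists_nat_ge (r + 1)
  obtain ⟨M, hM⟩ := (isCompact_closedBall (0 : ℂ) (N + r)).exists_bound_of_continuousOn
    differentiable_recipGamma.continuous.continuousOn
  refine ⟨M, fun n s hs => ?_⟩
  have hle : ∀ n : ℕ, n ≤ N → ‖recipGamma (n + s)‖ ≤ M := fun n hn => by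
    refine hM _ (mem_closedBall_zero_iff.2 ((norm_add_le _ _).trans ?_))
    rw [Complex.norm_natCast]
    gcongr
  rcases le_total n N with h | h
  · exact hle n h
  · induction n, h using Nat.le_induction with
    | base => exact hle N le_rfl
    | succ n hn ih =>
      have h1 : 1 ≤ ‖(n : ℂ) + s‖ := by
        have h2 := norm_sub_le_norm_add (n : ℂ) s
        rw [Complex.norm_natCast] at h2
        have h3 : (N : ℝ) ≤ n := by exact_mod_cast hn
        linarith
      have h2 := recipGamma_eq ((n : ℂ) + s)
      have h3 : ((n + 1 : ℕ) : ℂ) + s = n + s + 1 := by push_cast; ring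
      rw [h3]
      rw [h2, norm_mul] at ih
      nlinarith [norm_nonneg (recipGamma ((n : ℂ) + s + 1))]

/-! ### Coefficients of the Bessel series and their dependence on the order. -/

/-- The coefficients `1 / Γ(n + ν + 1)` of the Bessel series. -/
def gammaCoeff (ν : ℂ) (n : ℕ) : ℂ := recipGamma (n + ν + 1)

/-- The derivatives of `gammaCoeff ν n` with respect to `ν`. -/
def gammaCoeffDeriv (ν : ℂ) (n : ℕ) : ℂ := deriv recipGamma (n + ν + 1)

theorem exists_gammaCoeff_bound (r : ℝ) :
    ∃ M : ℝ, ∀ (n : ℕ) (ν : ℂ), ‖ν‖ ≤ r → ‖gammaCoeff ν n‖ ≤ M := by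
  obtain ⟨M, hM⟩ := exists_recipGamma_bound (r + 1)
  refine ⟨M, fun n ν hν => ?_⟩
  rw [gammaCoeff, add_assoc]
  refine hM n _ ((norm_add_le _ _).trans ?_)
  rw [norm_one]
  gcongr

theorem boundedCoeff_gammaCoeff (ν : ℂ) : BoundedCoeff (gammaCoeff ν) := by
  obtain ⟨M, hM⟩ := exists_gammaCoeff_bound ‖ν‖
  exact ⟨M, fun n => hM n ν le_rfl⟩

theorem hasDerivAt_gammaCoeff (ν : ℂ) (n : ℕ) :
    HasDerivAt (fun ν => gammaCoeff ν n) (gammaCoeffDeriv ν n) ν := by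
  have h : HasDerivAt (fun ν : ℂ => (n : ℂ) + ν + 1) 1 ν :=
    ((hasDerivAt_id ν).const_add _).add_const _
  simpa using! (differentiable_recipGamma ((n : ℂ) + ν + 1)).hasDerivAt.comp ν h

/-- Cauchy's estimate on the unit circle around `ν`, from the bound on `gammaCoeff` that is uniform
in the order. -/
theorem boundedCoeff_gammaCoeffDeriv (ν : ℂ) : BoundedCoeff (gammaCoeffDeriv ν) := by
  obtain ⟨M, hM⟩ := exists_gammaCoeff_bound (‖ν‖ + 1)
  refine ⟨M / 1, fun n => ?_⟩
  rw [← (hasDerivAt_gammaCoeff ν n).deriv]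
  refine Complex.norm_deriv_le_of_forall_mem_sphere_norm_le one_pos
    (Differentiable.diffContOnCl fun μ => (hasDerivAt_gammaCoeff μ n).differentiableAt) ?_
  intro μ hμ
  refine hM n μ ?_
  have h1 : ‖μ - ν‖ = 1 := by simpa [dist_eq_norm] using hμ
  have h2 : ‖μ‖ ≤ ‖ν‖ + ‖μ - ν‖ := by
    simpa using norm_add_le ν (μ - ν)
  linarith

theorem gammaCoeff_eq (ν : ℂ) (n : ℕ) : gammaCoeff ν n = (n + ν + 1) * gammaCoeff ν (n + 1) := by
  rw [gammaCoeff, recipGamma_eq, gammaCoeff]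
  push_cast
  ring_nf

theorem gammaCoeffDeriv_eq (ν : ℂ) (n : ℕ) :
    gammaCoeffDeriv ν n = (n + ν + 1) * gammaCoeffDeriv ν (n + 1) + gammaCoeff ν (n + 1) := by
  rw [gammaCoeffDeriv, deriv_recipGamma_eq, gammaCoeff, gammaCoeffDeriv]
  push_cast
  ring_nf

/-- The series of the Bessel function is differentiable in the order `ν`, term by term. -/
theorem hasDerivAt_expSeries_gammaCoeff (ν S : ℂ) :
    HasDerivAt (fun ν => expSeries (gammaCoeff ν) S) (expSeries (gammaCoeffDeriv ν) S) ν := by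
  obtain ⟨M, hM⟩ := exists_gammaCoeff_bound (‖ν‖ + 1)
  set F : ℕ → ℂ → ℂ := fun n ν => gammaCoeff ν n * ((-S / 4) ^ n / (n.factorial : ℂ)) with hF
  have hFd : ∀ n ν, HasDerivAt (F n)
      (gammaCoeffDeriv ν n * ((-S / 4) ^ n / (n.factorial : ℂ))) ν := fun n ν =>
    (hasDerivAt_gammaCoeff ν n).mul_const _
  have hu : Summable fun n : ℕ => M * (‖-S / 4‖ ^ n / (n.factorial : ℝ)) :=
    (Real.summable_pow_div_factorial _).mul_left M
  have hdiff : ∀ n, DifferentiableOn ℂ (F n) (Metric.ball 0 (‖ν‖ + 1)) := fun n μ _ =>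
    (hFd n μ).differentiableAt.differentiableWithinAt
  have hbound : ∀ n x, x ∈ Metric.ball (0 : ℂ) (‖ν‖ + 1) → ‖F n x‖ ≤
      M * (‖-S / 4‖ ^ n / (n.factorial : ℝ)) := by
    intro n x hx
    rw [norm_mul, norm_div, norm_pow, Complex.norm_natCast]
    gcongr
    exact hM n x (mem_ball_zero_iff.1 hx).le
  have hν : ν ∈ Metric.ball (0 : ℂ) (‖ν‖ + 1) := by simp
  have hderiv := Complex.hasSum_deriv_of_summable_norm hu hdiff Metric.isOpen_ball hbound hν
  have hdo : DifferentiableOn ℂ (fun x => ∑' n, F n x) (Metric.ball 0 (‖ν‖ + 1)) :=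
    Complex.differentiableOn_tsum_of_summable_norm hu hdiff Metric.isOpen_ball hbound
  have hd := (hdo.differentiableAt (Metric.isOpen_ball.mem_nhds hν)).hasDerivAt
  rw [← hderiv.tsum_eq] at hd
  simp only [(hFd _ ν).deriv] at hd
  exact hd

theorem besselSeries_eq (ν x : ℂ) : besselSeries ν x = expSeries (gammaCoeff ν) (x ^ 2) := by
  refine tsum_congr fun n => ?_
  have h : (-1) ^ n * (x / 2) ^ (2 * n) = (-x ^ 2 / 4) ^ n := by
    rw [pow_mul, ← mul_pow]
    ring
  rw [h, gammaCoeff, recipGamma]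
  have : (n.factorial : ℂ) ≠ 0 := by exact_mod_cast n.factorial_ne_zero
  rw [div_mul_eq_div_div, div_eq_mul_inv, mul_comm]

/-! ### Bessel functions of the second kind -/

/-- The `k`-th shift of the Bessel series, in the variable `S = x²`. -/
def besselPhi (ν : ℂ) (k : ℕ) (S : ℂ) : ℂ := expSeries (fun n => gammaCoeff ν (n + k)) S

/-- The derivative of `besselPhi` with respect to the order. -/
def besselPsi (ν : ℂ) (k : ℕ) (S : ℂ) : ℂ := expSeries (fun n => gammaCoeffDeriv ν (n + k)) S

theorem BoundedCoeff.shift_add {c : ℕ → ℂ} (hc : BoundedCoeff c) (k : ℕ) :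
    BoundedCoeff fun n => c (n + k) :=
  hc.imp fun _ h n => h (n + k)

theorem hasDerivAt_besselPhi (ν : ℂ) (k : ℕ) (S : ℂ) :
    HasDerivAt (besselPhi ν k) (-(1 / 4) * besselPhi ν (k + 1) S) S := by
  have h := hasDerivAt_expSeries ((boundedCoeff_gammaCoeff ν).shift_add k) S
  simp only [add_assoc, add_comm 1 k] at h
  exact h

theorem hasDerivAt_besselPsi (ν : ℂ) (k : ℕ) (S : ℂ) :
    HasDerivAt (besselPsi ν k) (-(1 / 4) * besselPsi ν (k + 1) S) S := by
  have h := hasDerivAt_expSeries ((boundedCoeff_gammaCoeffDeriv ν).shift_add k) S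
  simp only [add_assoc, add_comm 1 k] at h
  exact h

theorem differentiable_besselPhi (ν : ℂ) (k : ℕ) : Differentiable ℂ (besselPhi ν k) :=
  fun S => (hasDerivAt_besselPhi ν k S).differentiableAt

theorem differentiable_besselPsi (ν : ℂ) (k : ℕ) : Differentiable ℂ (besselPsi ν k) :=
  fun S => (hasDerivAt_besselPsi ν k S).differentiableAt

theorem besselPhi_ode (ν S : ℂ) :
    S / 4 * besselPhi ν 2 S - (ν + 1) * besselPhi ν 1 S + besselPhi ν 0 S = 0 := by
  have h := expSeries_ode (e := fun _ => 0) (boundedCoeff_gammaCoeff ν) ⟨0, by simp⟩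
    (fun n => by rw [add_zero, ← gammaCoeff_eq]) S
  rw [show expSeries (fun _ => 0) S = 0 by simp [expSeries]] at h
  exact h

theorem besselPsi_ode (ν S : ℂ) :
    S / 4 * besselPsi ν 2 S - (ν + 1) * besselPsi ν 1 S + besselPsi ν 0 S = besselPhi ν 1 S :=
  expSeries_ode (boundedCoeff_gammaCoeffDeriv ν) (boundedCoeff_gammaCoeff ν).shift
    (gammaCoeffDeriv_eq ν) S

theorem hasDerivAt_besselPhi_sq (ν : ℂ) (k : ℕ) (x : ℂ) :
    HasDerivAt (fun x => besselPhi ν k (x ^ 2)) (-(x / 2) * besselPhi ν (k + 1) (x ^ 2)) x := by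
  convert! (hasDerivAt_besselPhi ν k (x ^ 2)).comp x (hasDerivAt_pow 2 x) using 1
  push_cast
  ring

theorem hasDerivAt_besselPsi_sq (ν : ℂ) (k : ℕ) (x : ℂ) :
    HasDerivAt (fun x => besselPsi ν k (x ^ 2)) (-(x / 2) * besselPsi ν (k + 1) (x ^ 2)) x := by
  convert! (hasDerivAt_besselPsi ν k (x ^ 2)).comp x (hasDerivAt_pow 2 x) using 1
  push_cast
  ring

/-- The symmetry `J₋ₙ = (-1)ⁿ Jₙ`, in terms of the series. -/
theorem besselPhi_neg_nat (α : ℕ) (S : ℂ) :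
    besselPhi (-α) 0 S = (-S / 4) ^ α * besselPhi α 0 S := by
  have h1 := (hasSum_expSeries (boundedCoeff_gammaCoeff α) S).mul_left ((-S / 4) ^ α)
  have h2 : HasSum (fun n : ℕ => gammaCoeff (-α) n * ((-S / 4) ^ n / (n.factorial : ℂ)))
      ((-S / 4) ^ α * expSeries (gammaCoeff α) S) := by
    -- The first `α` coefficients are values of `1 / Γ` at non-positive integers, so they vanish;
    -- the rest is the series of order `α`, shifted.
    rw [← hasSum_nat_add_iff' α, Finset.sum_eq_zero, sub_zero]
    · convert! h1 using 1
      funext n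
      have e1 : gammaCoeff (-α) (n + α) = (n.factorial : ℂ)⁻¹ := by
        rw [gammaCoeff, recipGamma, ← Complex.Gamma_nat_eq_factorial]
        push_cast
        congr 2
        ring
      have e2 : gammaCoeff α n = ((n + α).factorial : ℂ)⁻¹ := by
        rw [gammaCoeff, recipGamma, ← Complex.Gamma_nat_eq_factorial]
        push_cast
        rfl
      rw [e1, e2, pow_add]
      ring
    · intro n hn
      have hn := Finset.mem_range.1 hn
      have : (n : ℂ) + -α + 1 = -((α - n - 1 : ℕ) : ℂ) := by
        rw [Nat.sub_sub, Nat.cast_sub (by omega)]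
        push_cast
        ring
      rw [gammaCoeff, this, recipGamma_neg_nat, zero_mul]
  exact h2.tsum_eq

/-- `(x/2)⁻ᵛ ∂J_ν(x)/∂ν`. -/
def besselV (ν x : ℂ) : ℂ :=
  Complex.log (x / 2) * besselPhi ν 0 (x ^ 2) + besselPsi ν 0 (x ^ 2)

/-- The derivative of `besselV ν`. -/
def besselV' (ν x : ℂ) : ℂ :=
  1 / x * besselPhi ν 0 (x ^ 2) -
    x / 2 * (Complex.log (x / 2) * besselPhi ν 1 (x ^ 2) + besselPsi ν 1 (x ^ 2))

theorem div_two_mem_slitPlane {x : ℂ} (hx : x ∈ Complex.slitPlane) :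
    x / 2 ∈ Complex.slitPlane := by
  rw [Complex.mem_slitPlane_iff] at hx ⊢
  have h1 : (x / 2).re = x.re / 2 := by simp
  have h2 : (x / 2).im = x.im / 2 := by simp
  rw [h1, h2]
  rcases hx with h | h
  · exact Or.inl (by positivity)
  · exact Or.inr (by simpa using h)

theorem hasDerivAt_log_half {x : ℂ} (hx : x ∈ Complex.slitPlane) :
    HasDerivAt (fun x => Complex.log (x / 2)) (1 / x) x := by
  have hx0 := Complex.slitPlane_ne_zero hx
  convert ((hasDerivAt_id x).div_const 2).clog (div_two_mem_slitPlane hx) using 1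
  simp only [id]
  field_simp
  exact (div_self hx0).symm

theorem hasDerivAt_besselV (ν : ℂ) {x : ℂ} (hx : x ∈ Complex.slitPlane) :
    HasDerivAt (besselV ν) (besselV' ν x) x := by
  convert! ((hasDerivAt_log_half hx).mul (hasDerivAt_besselPhi_sq ν 0 x)).add
    (hasDerivAt_besselPsi_sq ν 0 x) using 1
  rw [besselV']
  ring

/-- Write `L` for the Bessel operator of order `ν`, `φ` for the series and `ψ` for its
`ν`-derivative, both at `x²`. Then `L(log(x/2) φ) = 2νφ/x² + 2φ'/x`, while differentiating `Lφ = 0`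
in `ν` gives `Lψ = -2φ'/x`. The sum leaves `2νφ/x²`. -/
theorem hasDerivAt_besselV' (ν : ℂ) {x : ℂ} (hx : x ∈ Complex.slitPlane) :
    HasDerivAt (besselV' ν) (-((2 * ν + 1) / x * besselV' ν x) - besselV ν x +
      2 * ν * besselPhi ν 0 (x ^ 2) / x ^ 2) x := by
  have hx0 := Complex.slitPlane_ne_zero hx
  have h1 : HasDerivAt (fun x : ℂ => 1 / x) (-(1 / x ^ 2)) x := by
    simpa using hasDerivAt_inv hx0
  have h2 : HasDerivAt (fun x : ℂ => x / 2) (1 / 2) x := (hasDerivAt_id x).div_const 2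
  convert! (h1.mul (hasDerivAt_besselPhi_sq ν 0 x)).sub
    (h2.mul (((hasDerivAt_log_half hx).mul (hasDerivAt_besselPhi_sq ν 1 x)).add
    (hasDerivAt_besselPsi_sq ν 1 x))) using 1
  have e1 := besselPhi_ode ν (x ^ 2)
  have e2 := besselPsi_ode ν (x ^ 2)
  simp only [besselV', besselV]
  norm_num
  field_simp
  linear_combination (-4 * x ^ 2 * Complex.log (x / 2)) * e1 - 4 * x ^ 2 * e2

theorem hasDerivAt_besselJ_order (ν : ℂ) {x : ℂ} (hx : x ≠ 0) :
    HasDerivAt (fun ν => besselJ ν x) ((x / 2) ^ ν * besselV ν x) ν := by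
  have h1 : HasDerivAt (fun ν : ℂ => (x / 2) ^ ν) ((x / 2) ^ ν * Complex.log (x / 2) * 1) ν :=
    (hasDerivAt_id ν).const_cpow (Or.inl (div_ne_zero hx two_ne_zero))
  convert! h1.mul (hasDerivAt_expSeries_gammaCoeff ν (x ^ 2)) using 1
  · funext μ
    simp only [besselJ, besselSeries_eq, Pi.mul_apply]
  · simp only [besselV, besselPhi, besselPsi, add_zero]
    ring

theorem besselY_eq (n : ℕ) {x : ℂ} (hx : x ≠ 0) :
    besselY n x = 1 / (Real.pi : ℂ) * ((x / 2) ^ n * besselV n x +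
      (-1) ^ n * (((x / 2) ^ n)⁻¹ * besselV (-n) x)) := by
  have h1 := (hasDerivAt_besselJ_order (n : ℂ) hx).deriv
  have h2 : HasDerivAt (fun ν : ℂ => besselJ (-ν) x)
      ((x / 2) ^ (-n : ℂ) * besselV (-n) x * -1) n := by
    exact (hasDerivAt_besselJ_order (-n : ℂ) hx).comp (n : ℂ) (hasDerivAt_neg (n : ℂ))
  rw [besselY, h1, h2.deriv, Complex.cpow_neg, Complex.cpow_natCast]
  ring

theorem normBesselJ_eq_besselPhi (α : ℕ) (x : ℂ) :
    normBesselJ α x = Complex.Gamma (α + 1) * besselPhi α 0 (x ^ 2) := by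
  rw [normBesselJ, besselSeries_eq]
  rfl

theorem normBesselY_eq (α : ℕ) {x : ℂ} (hx : x ≠ 0) :
    normBesselY α x = Complex.Gamma (α + 1) / Real.pi *
      (besselV α x + (-4) ^ α * ((x ^ (2 * α))⁻¹ * besselV (-α) x)) := by
  have h4 : (-4 : ℂ) ^ α = (-1) ^ α * 2 ^ α * 2 ^ α := by
    rw [← mul_pow, ← mul_pow]
    norm_num
  rw [normBesselY, besselY_eq α hx, h4, div_pow, pow_mul', sq]
  field_simp

/-! ### The Bessel equation for `j_α` and `y_α`, and their Wronskian. -/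

/-- `u` solves the differential equation `u'' + (2α+1)/x u' + u = 0` of the normalized Bessel
functions at `x`, and `u'` is its derivative. -/
def SolvesBesselAt (α : ℕ) (u u' : ℂ → ℂ) (x : ℂ) : Prop :=
  HasDerivAt u (u' x) x ∧ HasDerivAt u' (-((2 * α + 1) / x * u' x) - u x) x

/-- The Wronskian, normalized so that it is constant. -/
def wronskian (α : ℕ) (u u' v v' : ℂ → ℂ) (x : ℂ) : ℂ :=
  x ^ (2 * α + 1) * (u x * v' x - u' x * v x)

theorem SolvesBesselAt.hasDerivAt_wronskian {α : ℕ} {u u' v v' : ℂ → ℂ} {x : ℂ} (hx : x ≠ 0)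
    (hu : SolvesBesselAt α u u' x) (hv : SolvesBesselAt α v v' x) :
    HasDerivAt (wronskian α u u' v v') 0 x := by
  convert! (hasDerivAt_pow (2 * α + 1) x).mul ((hu.1.mul hv.2).sub (hu.2.mul hv.1)) using 1
  simp only [Pi.mul_apply, Pi.sub_apply, Nat.add_sub_cancel, pow_succ]
  push_cast
  field_simp
  ring

/-- The derivative of `normBesselJ α`. -/
def normBesselJ' (α : ℕ) (x : ℂ) : ℂ :=
  Complex.Gamma (α + 1) * (-(x / 2) * besselPhi α 1 (x ^ 2))

/-- The derivative of `normBesselY α`. -/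
def normBesselY' (α : ℕ) (x : ℂ) : ℂ :=
  Complex.Gamma (α + 1) / Real.pi *
    (besselV' α x + (-4) ^ α * ((x ^ (2 * α))⁻¹ * besselV' (-α) x -
      2 * α / x * (x ^ (2 * α))⁻¹ * besselV (-α) x))

theorem solvesBesselAt_normBesselJ (α : ℕ) {x : ℂ} (hx : x ≠ 0) :
    SolvesBesselAt α (normBesselJ α) (normBesselJ' α) x := by
  constructor
  · rw [funext (normBesselJ_eq_besselPhi α)]
    exact (hasDerivAt_besselPhi_sq α 0 x).const_mul _
  · have h2 : HasDerivAt (fun x : ℂ => -(x / 2)) (-(1 / 2)) x := ((hasDerivAt_id x).div_const 2).neg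
    convert! (h2.mul (hasDerivAt_besselPhi_sq α 1 x)).const_mul (Complex.Gamma (α + 1)) using 1
    rw [normBesselJ_eq_besselPhi, normBesselJ']
    have e1 := besselPhi_ode α (x ^ 2)
    field_simp
    linear_combination (-4 * Complex.Gamma (α + 1)) * e1

theorem hasDerivAt_inv_pow (k : ℕ) {x : ℂ} (hx : x ≠ 0) :
    HasDerivAt (fun x : ℂ => (x ^ k)⁻¹) (-(k / x * (x ^ k)⁻¹)) x := by
  convert! (hasDerivAt_pow k x).inv (pow_ne_zero k hx) using 1
  rcases k with _ | k
  · simp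
  · simp only [Nat.add_sub_cancel, pow_succ]
    field_simp

/-- Multiplication by `x^(-2α)` carries the operator of order `-α` to that of order `α`. The defects
`2αφ_α/x²` and `-2αφ_{-α}/x²` of the two summands then cancel by the symmetry `J₋ₙ = (-1)ⁿ Jₙ`,
which is `hsym` below. -/
theorem solvesBesselAt_normBesselY (α : ℕ) {x : ℂ} (hx : x ∈ Complex.slitPlane) :
    SolvesBesselAt α (normBesselY α) (normBesselY' α) x := by
  have hx0 := Complex.slitPlane_ne_zero hx
  have hinv : HasDerivAt (fun x : ℂ => (x ^ (2 * α))⁻¹) (-(2 * α / x * (x ^ (2 * α))⁻¹)) x := by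
    have := hasDerivAt_inv_pow (2 * α) hx0
    push_cast at this
    exact this
  have hdiv : HasDerivAt (fun x : ℂ => 2 * (α : ℂ) / x) (-(2 * α / x ^ 2)) x := by
    convert! (hasDerivAt_inv hx0).const_mul (2 * (α : ℂ)) using 1
    ring
  constructor
  · have h : HasDerivAt (fun x => Complex.Gamma (α + 1) / Real.pi *
        (besselV α x + (-4) ^ α * ((x ^ (2 * α))⁻¹ * besselV (-α) x))) (normBesselY' α x) x := by
      convert! ((hasDerivAt_besselV α hx).add ((hinv.mul
        (hasDerivAt_besselV (-α) hx)).const_mul ((-4 : ℂ) ^ α))).const_mul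
        (Complex.Gamma (α + 1) / Real.pi) using 1
      rw [normBesselY']
      ring
    refine h.congr_of_eventuallyEq ?_
    filter_upwards [isOpen_ne.mem_nhds hx0] with y hy using normBesselY_eq α hy
  · convert! ((hasDerivAt_besselV' α hx).add (((hinv.mul
        (hasDerivAt_besselV' (-α) hx)).sub ((hdiv.mul hinv).mul
        (hasDerivAt_besselV (-α) hx))).const_mul ((-4 : ℂ) ^ α))).const_mul
        (Complex.Gamma (α + 1) / Real.pi) using 1
    have hsym : (-4) ^ α * (x ^ (2 * α))⁻¹ * besselPhi (-α) 0 (x ^ 2) = besselPhi α 0 (x ^ 2) := by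
      have h1 : (-4) ^ α * (-x ^ 2 / 4) ^ α = x ^ (2 * α) := by
        rw [← mul_pow, pow_mul]
        congr 1
        ring
      rw [besselPhi_neg_nat]
      field_simp
      linear_combination (besselPhi α 0 (x ^ 2)) * h1
    rw [normBesselY_eq α hx0, normBesselY']
    simp only [Pi.mul_apply]
    rw [← hsym]
    generalize (x ^ (2 * α))⁻¹ = q
    field_simp
    ring

/-- This is the derivative of `besselPhi_neg_nat`; the factor `S` avoids the power `α - 1`. -/
theorem mul_besselPhi_neg_nat_one (α : ℕ) (S : ℂ) :
    S * besselPhi (-α) 1 S =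
      (-S / 4) ^ α * (-4 * α * besselPhi α 0 S + S * besselPhi α 1 S) := by
  have h1 : HasDerivAt (fun S : ℂ => -S / 4) (-1 / 4) S := (hasDerivAt_id S).neg.div_const 4
  have h2 := (h1.pow α).mul (hasDerivAt_besselPhi α 0 S)
  have h3 := hasDerivAt_besselPhi (-α) 0 S
  rw [funext (besselPhi_neg_nat α)] at h3
  have h4 := h3.unique h2
  have h5 : S * (α * (-S / 4) ^ (α - 1)) = -4 * α * (-S / 4) ^ α := by
    rcases α with _ | k
    · simp
    · simp only [Nat.add_sub_cancel, pow_succ]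
      ring
  simp only [zero_add, Pi.pow_apply] at h4
  linear_combination (-4 * S) * h4 + besselPhi α 0 S * h5

theorem neg_four_pow_mul (α : ℕ) {x : ℂ} (hx : x ≠ 0) :
    (-4) ^ α * (x ^ (2 * α))⁻¹ * (-x ^ 2 / 4) ^ α = 1 := by
  have h1 : (-4) ^ α * (-x ^ 2 / 4) ^ α = x ^ (2 * α) := by
    rw [← mul_pow, pow_mul]
    congr 1
    ring
  rw [mul_right_comm, h1]
  exact mul_inv_cancel₀ (pow_ne_zero _ hx)

/-- Both parts of `y_α` carry the same `log(x/2) j_α`, and the Wronskian of `j_α` with that product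
retains only the derivative of the logarithm. The right-hand side is therefore entire and can be
evaluated at `0`, outside the slit plane. -/
theorem wronskian_normBessel_eq (α : ℕ) {x : ℂ} (hx : x ∈ Complex.slitPlane) :
    wronskian α (normBesselJ α) (normBesselJ' α) (normBesselY α) (normBesselY' α) x =
      Complex.Gamma (α + 1) ^ 2 / Real.pi * (2 * x ^ (2 * α) * besselPhi α 0 (x ^ 2) ^ 2 +
        x ^ (2 * α + 1) * (-(x / 2)) * (besselPhi α 0 (x ^ 2) * besselPsi α 1 (x ^ 2) -
          besselPhi α 1 (x ^ 2) * besselPsi α 0 (x ^ 2)) +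
        (-4) ^ α * x * (-(x / 2)) * (besselPhi α 0 (x ^ 2) * besselPsi (-α) 1 (x ^ 2) -
          besselPhi α 1 (x ^ 2) * besselPsi (-α) 0 (x ^ 2)) -
        2 * α * (-4) ^ α * besselPhi α 0 (x ^ 2) * besselPsi (-α) 0 (x ^ 2)) := by
  have hx0 := Complex.slitPlane_ne_zero hx
  have hpi : (Real.pi : ℂ) ≠ 0 := by exact_mod_cast Real.pi_ne_zero
  have hk := neg_four_pow_mul α hx0
  have e0 : (-4) ^ α * (x ^ (2 * α))⁻¹ * besselPhi (-α) 0 (x ^ 2) = besselPhi α 0 (x ^ 2) := by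
    rw [besselPhi_neg_nat]
    linear_combination besselPhi α 0 (x ^ 2) * hk
  have e1 : (-4) ^ α * (x ^ (2 * α))⁻¹ * (x ^ 2 * besselPhi (-α) 1 (x ^ 2)) =
      -4 * α * besselPhi α 0 (x ^ 2) + x ^ 2 * besselPhi α 1 (x ^ 2) := by
    rw [mul_besselPhi_neg_nat_one]
    linear_combination (-4 * α * besselPhi α 0 (x ^ 2) + x ^ 2 * besselPhi α 1 (x ^ 2)) * hk
  have e2 : x ^ (2 * α) * (x ^ (2 * α))⁻¹ = 1 := mul_inv_cancel₀ (pow_ne_zero _ hx0)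
  rw [wronskian, normBesselJ_eq_besselPhi, normBesselY_eq α hx0, normBesselJ', normBesselY',
    pow_succ]
  simp only [besselV, besselV']
  generalize (x ^ (2 * α))⁻¹ = q at *
  generalize x ^ (2 * α) = r at *
  generalize (-4 : ℂ) ^ α = κ at *
  generalize besselPhi (-α) 0 (x ^ 2) = a0 at *
  generalize besselPhi (-α) 1 (x ^ 2) = a1 at *
  generalize besselPhi α 0 (x ^ 2) = b0 at *
  generalize besselPhi α 1 (x ^ 2) = b1 at *
  generalize besselPsi (-α) 0 (x ^ 2) = c0 at *
  generalize besselPsi (-α) 1 (x ^ 2) = c1 at *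
  generalize Complex.log (x / 2) = l at *
  generalize Complex.Gamma (α + 1) = N at *
  have hY0 : l * b0 + besselPsi α 0 (x ^ 2) + κ * (q * (l * a0 + c0)) =
      2 * l * b0 + besselPsi α 0 (x ^ 2) + κ * q * c0 := by
    linear_combination l * e0
  have hY1 : 1 / x * b0 - x / 2 * (l * b1 + besselPsi α 1 (x ^ 2)) +
      κ * (q * (1 / x * a0 - x / 2 * (l * a1 + c1)) - 2 * α / x * q * (l * a0 + c0)) =
      2 * b0 / x - x * l * b1 - x / 2 * besselPsi α 1 (x ^ 2) +
        κ * q * (-(x / 2) * c1 - 2 * α / x * c0) := by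
    field_simp
    linear_combination (2 - 4 * l * α) * e0 - l * e1
  rw [hY0, hY1]
  field_simp
  linear_combination (N ^ 2 * κ * (x * (-x * b0 * c1 + x * b1 * c0) - 4 * α * b0 * c0)) * e2

theorem isPreconnected_slitPlane : IsPreconnected Complex.slitPlane :=
  (Complex.starConvex_one_slitPlane.isPathConnected
    Complex.one_mem_slitPlane).isConnected.isPreconnected

/-- The Wronskian of `j_α` and `y_α` is a nonzero constant. -/
theorem wronskian_normBessel_ne_zero (α : ℕ) {x : ℂ} (hx : x ∈ Complex.slitPlane) :
    wronskian α (normBesselJ α) (normBesselJ' α) (normBesselY α) (normBesselY' α) x ≠ 0 := by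
  set W := wronskian α (normBesselJ α) (normBesselJ' α) (normBesselY α) (normBesselY' α)
  have hpi : (Real.pi : ℂ) ≠ 0 := by exact_mod_cast Real.pi_ne_zero
  have hN : Complex.Gamma (α + 1) ≠ 0 := by
    rw [Complex.Gamma_nat_eq_factorial]
    exact_mod_cast α.factorial_ne_zero
  have hphi : besselPhi α 0 (0 ^ 2) ≠ 0 := by
    rw [zero_pow two_ne_zero, besselPhi, expSeries_zero, gammaCoeff, recipGamma]
    simpa using hN
  intro h0
  have hW : ∀ y ∈ Complex.slitPlane, W y = 0 := fun y hy => by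
    rw [← h0]
    refine Complex.isOpen_slitPlane.is_const_of_deriv_eq_zero
      isPreconnected_slitPlane
      (fun t ht => (((solvesBesselAt_normBesselJ α (Complex.slitPlane_ne_zero ht)
        ).hasDerivAt_wronskian (Complex.slitPlane_ne_zero ht)
        (solvesBesselAt_normBesselY α ht)).differentiableAt).differentiableWithinAt)
      (fun t ht => ((solvesBesselAt_normBesselJ α (Complex.slitPlane_ne_zero ht)
        ).hasDerivAt_wronskian (Complex.slitPlane_ne_zero ht)
        (solvesBesselAt_normBesselY α ht)).deriv) hy hx
  set H : ℂ → ℂ := fun x => (2 * x ^ (2 * α) * besselPhi α 0 (x ^ 2) ^ 2 +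
        x ^ (2 * α + 1) * (-(x / 2)) * (besselPhi α 0 (x ^ 2) * besselPsi α 1 (x ^ 2) -
          besselPhi α 1 (x ^ 2) * besselPsi α 0 (x ^ 2)) +
        (-4) ^ α * x * (-(x / 2)) * (besselPhi α 0 (x ^ 2) * besselPsi (-α) 1 (x ^ 2) -
          besselPhi α 1 (x ^ 2) * besselPsi (-α) 0 (x ^ 2)) -
        2 * α * (-4) ^ α * besselPhi α 0 (x ^ 2) * besselPsi (-α) 0 (x ^ 2)) with hH
  have hcont : Continuous H := by
    have c0 := fun ν k => (differentiable_besselPhi ν k).continuous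
    have c1 := fun ν k => (differentiable_besselPsi ν k).continuous
    fun_prop
  have hHz : ∀ y ∈ Complex.slitPlane, H y = 0 := fun y hy => by
    have h1 := wronskian_normBessel_eq α hy
    rw [show wronskian α _ _ _ _ y = 0 from hW y hy] at h1
    refine (mul_eq_zero.1 h1.symm).resolve_left ?_
    exact div_ne_zero (pow_ne_zero _ hN) hpi
  -- `H` is continuous and `0` lies in the closure of the slit plane.
  have hH0 : H 0 = 0 := by
    have hcl : (0 : ℂ) ∈ closure Complex.slitPlane := by
      have hlim : Tendsto (fun n : ℕ => (1 / ((n : ℂ) + 1))) atTop (𝓝 0) :=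
        tendsto_one_div_add_atTop_nhds_zero_nat
      refine mem_closure_of_tendsto hlim (Eventually.of_forall fun n => ?_)
      have : (1 / ((n : ℂ) + 1)) = ((1 / ((n : ℝ) + 1) : ℝ) : ℂ) := by push_cast; rfl
      rw [this, Complex.ofReal_mem_slitPlane]
      positivity
    exact closure_minimal hHz (isClosed_eq hcont continuous_const) hcl
  -- At `0` only the first term of `H` survives if `α = 0`, and only the last if `α = k + 1`; the
  -- latter contains the derivative of `1 / Γ` at `-k`.
  rcases α with _ | k
  · simp [hH] at hH0
    simp at hphi
    exact hphi hH0
  · simp only [hH] at hH0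
    have hpsi : besselPsi (-((k + 1 : ℕ) : ℂ)) 0 (0 ^ 2) ≠ 0 := by
      rw [zero_pow two_ne_zero, besselPsi, expSeries_zero, gammaCoeffDeriv]
      convert deriv_recipGamma_neg_nat_ne_zero k using 2
      push_cast
      ring
    have h2 : (2 * ((k + 1 : ℕ) : ℂ)) * (-4) ^ (k + 1) ≠ 0 :=
      mul_ne_zero (mul_ne_zero two_ne_zero (Nat.cast_ne_zero.2 k.succ_ne_zero))
        (pow_ne_zero _ (by norm_num))
    refine mul_ne_zero (mul_ne_zero h2 hphi) hpsi ?_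
    rw [zero_pow (by omega : 2 * (k + 1) ≠ 0)] at hH0
    linear_combination -hH0

/-! ### Contour integrals -/

/-- The fundamental theorem of calculus for piecewise `C¹` contours. -/
theorem contourIntegral_eq_sub {F P : ℂ → ℂ} (hF : Continuous F)
    (hP : ∀ ζ, HasDerivAt P (F ζ) ζ) {a b : ℂ} (γ : Path a b) (hγ : IsPiecewiseC1 γ) :
    contourIntegral F γ = P b - P a := by
  obtain ⟨n, t, hmono, h0, h1, hC⟩ := hγ
  set G : ℝ → ℂ := fun s => F (γ.extend s) * deriv γ.extend s
  have hPc : Continuous P := Differentiable.continuous (𝕜 := ℂ) fun ζ => (hP ζ).differentiableAt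
  have hint : contourIntegral F γ = ∫ s in (0 : ℝ)..1, G s := by
    rw [contourIntegral, curveIntegral_eq_intervalIntegral_deriv]
    simp [G]
  have hpiece : ∀ i < n, IntervalIntegrable G MeasureTheory.volume (t i) (t (i + 1)) ∧
      ∫ s in (t i)..(t (i + 1)), G s = P (γ.extend (t (i + 1))) - P (γ.extend (t i)) := by
    intro i hi
    have hle : t i ≤ t (i + 1) := hmono i.le_succ
    rcases hle.eq_or_lt with heq | hlt
    · rw [← heq]
      simp
    have hder : ∀ s ∈ Ioo (t i) (t (i + 1)),
        HasDerivAt γ.extend (deriv γ.extend s) s := fun s hs =>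
      (((hC i hi).differentiableOn one_ne_zero s (Ioo_subset_Icc_self hs)).differentiableAt
        (Icc_mem_nhds hs.1 hs.2)).hasDerivAt
    -- At a breakpoint `deriv` may be a junk value; `derivWithin` is continuous up to the ends of
    -- the piece and agrees with `deriv` inside.
    have hcont : ContinuousOn (fun s => F (γ.extend s) *
        derivWithin γ.extend (Icc (t i) (t (i + 1))) s) (Icc (t i) (t (i + 1))) :=
      (hF.comp γ.continuous_extend).continuousOn.mul
        ((hC i hi).continuousOn_derivWithin (uniqueDiffOn_Icc hlt) le_rfl)
    have hii : IntervalIntegrable G MeasureTheory.volume (t i) (t (i + 1)) := by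
      have h2 : IntervalIntegrable (fun s => F (γ.extend s) *
          derivWithin γ.extend (Icc (t i) (t (i + 1))) s) MeasureTheory.volume
          (t i) (t (i + 1)) := by
        apply ContinuousOn.intervalIntegrable
        rwa [uIcc_of_le hle]
      refine h2.congr_uIoo ?_
      intro s hs
      rw [uIoo_of_le hle] at hs
      simp only [G]
      rw [derivWithin_of_mem_nhds (Icc_mem_nhds hs.1 hs.2)]
    refine ⟨hii, ?_⟩
    refine intervalIntegral.integral_eq_sub_of_hasDerivAt_of_le (f := fun s => P (γ.extend s)) hle
      (hPc.comp γ.continuous_extend).continuousOn (fun s hs => ?_) hii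
    exact (hP (γ.extend s)).comp s (hder s hs)
  have hsum := intervalIntegral.sum_integral_adjacent_intervals (fun i hi => (hpiece i hi).1)
  rw [h0, h1] at hsum
  rw [hint, ← hsum, Finset.sum_congr rfl fun i hi => (hpiece i (Finset.mem_range.1 hi)).2,
    Finset.sum_range_sub fun i => P (γ.extend (t i)), h0, h1]
  simp

/-! ### Integrals over segments with a moving endpoint. -/

/-- Differentiation under the integral sign over `[0, 1]`, for a jointly continuous derivative. -/
theorem hasDerivAt_intervalIntegral_of_continuousOn {U : Set ℂ} (hU : IsOpen U)
    {K K' : ℂ → ℝ → ℂ} (hK : ContinuousOn (Function.uncurry K) (U ×ˢ univ))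
    (hK' : ContinuousOn (Function.uncurry K') (U ×ˢ univ))
    (hd : ∀ z ∈ U, ∀ t, HasDerivAt (fun z => K z t) (K' z t) z) {z : ℂ} (hz : z ∈ U) :
    HasDerivAt (fun z => ∫ t in (0 : ℝ)..1, K z t) (∫ t in (0 : ℝ)..1, K' z t) z := by
  obtain ⟨ε, hε, hball⟩ := Metric.nhds_basis_closedBall.mem_iff.1 (hU.mem_nhds hz)
  have hslice : ∀ {L : ℂ → ℝ → ℂ}, ContinuousOn (Function.uncurry L) (U ×ˢ univ) →
      ∀ y ∈ U, Continuous (L y) := fun {L} hL y hy => by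
    have h : ContinuousOn (fun t : ℝ => Function.uncurry L (y, t)) univ :=
      hL.comp (by fun_prop) fun t _ => ⟨hy, mem_univ _⟩
    exact continuousOn_univ.1 h
  obtain ⟨M, hM⟩ := ((isCompact_closedBall z ε).prod (isCompact_Icc (a := (0 : ℝ)) (b := 1))
    ).exists_bound_of_continuousOn (hK'.mono (prod_mono hball (subset_univ _)))
  refine (intervalIntegral.hasDerivAt_integral_of_dominated_loc_of_deriv_le
    (s := Metric.closedBall z ε) (bound := fun _ => M) (Metric.closedBall_mem_nhds z hε)
    ?_ ?_ ?_ ?_ ?_ ?_).2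
  · filter_upwards [hU.mem_nhds hz] with y hy using (hslice hK y hy).aestronglyMeasurable
  · exact (hslice hK z hz).intervalIntegrable _ _
  · exact (hslice hK' z hz).aestronglyMeasurable
  · refine Eventually.of_forall fun t ht y hy => hM (y, t) ⟨hy, ?_⟩
    rw [uIoc_of_le zero_le_one] at ht
    exact Ioc_subset_Icc_self ht
  · exact intervalIntegrable_const
  · exact Eventually.of_forall fun t _ y hy => hd y (hball hy) t

/-- The integral of `A(z, ·)` along the segment from `0` to `ℓ(z)`. -/
def segmentIntegral (A : ℂ → ℂ → ℂ) (ℓ : ℂ → ℂ) (z : ℂ) : ℂ :=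
  ∫ t in (0 : ℝ)..1, ℓ z * A z (t * ℓ z)

theorem hasDerivAt_comp_two {A : ℂ → ℂ → ℂ} (hA : Differentiable ℂ (Function.uncurry A))
    {f g : ℂ → ℂ} {f' g' p q z : ℂ} (hf : HasDerivAt f f' z) (hg : HasDerivAt g g' z)
    (hp : HasDerivAt (fun x => A x (g z)) p (f z)) (hq : HasDerivAt (fun ζ => A (f z) ζ) q (g z)) :
    HasDerivAt (fun z => A (f z) (g z)) (f' * p + g' * q) z := by
  have hD := (hA (f z, g z)).hasFDerivAt
  set D := fderiv ℂ (Function.uncurry A) (f z, g z)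
  have h1 : D (1, 0) = p := by
    have h : HasDerivAt (fun x => A x (g z)) (D (1, 0)) (f z) :=
      HasFDerivAt.comp_hasDerivAt (l := Function.uncurry A) (f z) hD
        ((hasDerivAt_id (f z)).prodMk (hasDerivAt_const (f z) (g z)))
    exact h.unique hp
  have h2 : D (0, 1) = q := by
    have h : HasDerivAt (fun ζ => A (f z) ζ) (D (0, 1)) (g z) :=
      HasFDerivAt.comp_hasDerivAt (l := Function.uncurry A) (g z) hD
        ((hasDerivAt_const (g z) (f z)).prodMk (hasDerivAt_id (g z)))
    exact h.unique hq
  have h3 := hD.comp_hasDerivAt z (hf.prodMk hg)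
  have h4 : (f', g') = f' • ((1, 0) : ℂ × ℂ) + g' • ((0, 1) : ℂ × ℂ) := by simp
  rw [h4, map_add, map_smul, map_smul, h1, h2] at h3
  exact h3

/-- The integral of a derivative along a segment. -/
theorem segmentIntegral_deriv {A Aζ : ℂ → ℂ → ℂ} {ℓ : ℂ → ℂ} {z : ℂ}
    (hq : ∀ ζ, HasDerivAt (A z) (Aζ z ζ) ζ) (cq : Continuous (Aζ z)) :
    segmentIntegral Aζ ℓ z = A z (ℓ z) - A z 0 := by
  have h := intervalIntegral.integral_eq_sub_of_hasDerivAt (a := 0) (b := 1)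
    (f := fun t : ℝ => A z (t * ℓ z)) (f' := fun t : ℝ => ℓ z * Aζ z (t * ℓ z)) (fun t _ => ?_)
    (Continuous.intervalIntegrable (by fun_prop) _ _)
  · rw [segmentIntegral, h]
    simp
  · have h1 : HasDerivAt (fun t : ℝ => (t : ℂ) * ℓ z) (1 * ℓ z) t :=
      (Complex.ofRealCLM.hasDerivAt (x := t)).mul_const (ℓ z)
    convert! (hq (t * ℓ z)).comp t h1 using 1
    ring

/-- Leibniz' rule. After rescaling to `[0, 1]`, the terms containing `ℓ'` combine to the
`t`-derivative of `t A(z, tℓ)`, which integrates to the endpoint value. -/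
theorem hasDerivAt_segmentIntegral {A Az Aζ : ℂ → ℂ → ℂ}
    (hA : Differentiable ℂ (Function.uncurry A))
    (hp : ∀ z ζ, HasDerivAt (fun x => A x ζ) (Az z ζ) z)
    (hq : ∀ z ζ, HasDerivAt (A z) (Aζ z ζ) ζ)
    (cp : Continuous (Function.uncurry Az)) (cq : Continuous (Function.uncurry Aζ))
    {U : Set ℂ} (hU : IsOpen U) {ℓ ℓ' : ℂ → ℂ} (hℓ : ∀ z ∈ U, HasDerivAt ℓ (ℓ' z) z)
    (cℓ' : ContinuousOn ℓ' U) {z : ℂ} (hz : z ∈ U) :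
    HasDerivAt (segmentIntegral A ℓ) (segmentIntegral Az ℓ z + ℓ' z * A z (ℓ z)) z := by
  have cA := hA.continuous
  have cℓ : ContinuousOn ℓ U := fun z hz => (hℓ z hz).continuousAt.continuousWithinAt
  have c1 : ContinuousOn (fun x : ℂ × ℝ => ℓ x.1) (U ×ˢ univ) :=
    cℓ.comp continuousOn_fst fun x hx => hx.1
  have c2 : ContinuousOn (fun x : ℂ × ℝ => ℓ' x.1) (U ×ˢ univ) :=
    cℓ'.comp continuousOn_fst fun x hx => hx.1
  have c3 : ContinuousOn (fun x : ℂ × ℝ => (x.1, (x.2 : ℂ) * ℓ x.1)) (U ×ˢ univ) :=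
    continuousOn_fst.prodMk ((by fun_prop : Continuous fun x : ℂ × ℝ => (x.2 : ℂ)).continuousOn.mul
      c1)
  set K' : ℂ → ℝ → ℂ := fun z t => ℓ z * Az z (t * ℓ z) +
    ℓ' z * (A z (t * ℓ z) + t * ℓ z * Aζ z (t * ℓ z)) with hK'
  have hd : ∀ z ∈ U, ∀ t : ℝ, HasDerivAt (fun z => ℓ z * A z (t * ℓ z)) (K' z t) z := by
    intro z hz t
    have h := (hℓ z hz).mul (hasDerivAt_comp_two hA (hasDerivAt_id z) ((hℓ z hz).const_mul (t : ℂ))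
      (hp _ _) (hq _ _))
    convert! h using 1
    simp only [hK', id]
    ring
  have hK'c : ContinuousOn (Function.uncurry K') (U ×ˢ univ) := by
    refine (c1.mul (cp.comp_continuousOn c3)).add (c2.mul ((cA.comp_continuousOn c3).add ?_))
    exact ((by fun_prop : Continuous fun x : ℂ × ℝ => (x.2 : ℂ)).continuousOn.mul c1).mul
      (cq.comp_continuousOn c3)
  have hmain := hasDerivAt_intervalIntegral_of_continuousOn hU
    (K := fun z t => ℓ z * A z (t * ℓ z)) (c1.mul (cA.comp_continuousOn c3)) hK'c hd hz
  have cpz : Continuous (Az z) := cp.comp (by fun_prop : Continuous fun ζ => (z, ζ))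
  have cAz : Continuous (A z) := cA.comp (by fun_prop : Continuous fun ζ => (z, ζ))
  have cqz : Continuous (Aζ z) := cq.comp (by fun_prop : Continuous fun ζ => (z, ζ))
  have hftc := intervalIntegral.integral_eq_sub_of_hasDerivAt (a := 0) (b := 1)
    (f := fun t : ℝ => (t : ℂ) * A z (t * ℓ z))
    (f' := fun t : ℝ => A z (t * ℓ z) + t * ℓ z * Aζ z (t * ℓ z)) (fun t _ => by
      have h1 : HasDerivAt (fun t : ℝ => (t : ℂ) * ℓ z) (1 * ℓ z) t :=
        (Complex.ofRealCLM.hasDerivAt (x := t)).mul_const (ℓ z)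
      convert! (Complex.ofRealCLM.hasDerivAt (x := t)).mul ((hq z (t * ℓ z)).comp t h1) using 1
      simp
      ring) (Continuous.intervalIntegrable (by fun_prop) _ _)
  convert! hmain using 1
  simp only [hK']
  rw [intervalIntegral.integral_add (Continuous.intervalIntegrable (by fun_prop) _ _)
    (Continuous.intervalIntegrable (by fun_prop) _ _), intervalIntegral.integral_const_mul,
    intervalIntegral.integral_const_mul, hftc]
  simp [segmentIntegral]

/-- The segment integral from `0` is itself a primitive of `F`, by Leibniz' rule with an integrand
that does not depend on the parameter. -/
theorem contourIntegral_eq_segmentIntegral {F : ℂ → ℂ} (hF : Differentiable ℂ F)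
    (cF : Continuous (deriv F)) {b : ℂ} (γ : Path 0 b) (hγ : IsPiecewiseC1 γ) :
    contourIntegral F γ = ∫ t in (0 : ℝ)..1, b * F (t * b) := by
  have h := contourIntegral_eq_sub (P := segmentIntegral (fun _ ζ => F ζ) id) hF.continuous
    (fun ζ => by
      have h := hasDerivAt_segmentIntegral (A := fun _ ζ => F ζ) (Az := fun _ _ => 0)
        (Aζ := fun _ ζ => deriv F ζ) (hF.comp differentiable_snd)
        (fun z ζ => hasDerivAt_const _ _) (fun z ζ => (hF ζ).hasDerivAt) continuous_const
        (cF.comp continuous_snd) isOpen_univ (ℓ := id) (ℓ' := fun _ => 1)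
        (fun z _ => hasDerivAt_id z) continuousOn_const (mem_univ ζ)
      simpa [segmentIntegral] using h) γ hγ
  rw [h]
  simp [segmentIntegral]

theorem hasDerivAt_segmentIntegral_of_contDiff {A Az : ℂ → ℂ → ℂ}
    (hA : ContDiff ℂ 1 (Function.uncurry A))
    (hp : ∀ z ζ, HasDerivAt (fun x => A x ζ) (Az z ζ) z)
    {U : Set ℂ} (hU : IsOpen U) {ℓ ℓ' : ℂ → ℂ} (hℓ : ∀ z ∈ U, HasDerivAt ℓ (ℓ' z) z)
    (cℓ' : ContinuousOn ℓ' U) {z : ℂ} (hz : z ∈ U) :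
    HasDerivAt (segmentIntegral A ℓ) (segmentIntegral Az ℓ z + ℓ' z * A z (ℓ z)) z := by
  have hd := hA.differentiable one_ne_zero
  have hc := hA.continuous_fderiv one_ne_zero
  have e1 : ∀ z ζ, fderiv ℂ (Function.uncurry A) (z, ζ) (1, 0) = Az z ζ := fun z ζ => by
    have h : HasDerivAt (fun x => A x ζ) (fderiv ℂ (Function.uncurry A) (z, ζ) (1, 0)) z :=
      HasFDerivAt.comp_hasDerivAt (l := Function.uncurry A) z (hd (z, ζ)).hasFDerivAt
        ((hasDerivAt_id z).prodMk (hasDerivAt_const z ζ))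
    exact h.unique (hp z ζ)
  have e2 : ∀ z ζ, HasDerivAt (A z) (fderiv ℂ (Function.uncurry A) (z, ζ) (0, 1)) ζ := fun z ζ =>
    HasFDerivAt.comp_hasDerivAt (l := Function.uncurry A) ζ (hd (z, ζ)).hasFDerivAt
        ((hasDerivAt_const ζ z).prodMk (hasDerivAt_id ζ))
  refine hasDerivAt_segmentIntegral hd hp
    (Aζ := fun z ζ => fderiv ℂ (Function.uncurry A) (z, ζ) (0, 1)) e2 ?_ ?_ hU hℓ cℓ' hz
  · have : Function.uncurry Az = fun x => fderiv ℂ (Function.uncurry A) x (1, 0) := by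
      funext ⟨z, ζ⟩
      exact (e1 z ζ).symm
    rw [this]
    fun_prop
  · have : Function.uncurry (fun z ζ => fderiv ℂ (Function.uncurry A) (z, ζ) (0, 1)) =
      fun x => fderiv ℂ (Function.uncurry A) x (0, 1) := rfl
    rw [this]
    fun_prop

/-! ### The integral in Nicholson's formula as a function of `z` -/

/-- The argument `z² + w² - 2zw cosh ζ`. -/
def chordSq (w z ζ : ℂ) : ℂ := z ^ 2 + w ^ 2 - 2 * z * w * Complex.cosh ζ

/-- The kernel `j_α(√(chordSq)) sinh^{2α} ζ / Γ(α+1)`. -/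
def kernel (α : ℕ) (w z ζ : ℂ) : ℂ := besselPhi α 0 (chordSq w z ζ) * Complex.sinh ζ ^ (2 * α)

/-- The first `z`-derivative of `kernel`. -/
def kernelZ (α : ℕ) (w z ζ : ℂ) : ℂ :=
  -(1 / 4) * besselPhi α 1 (chordSq w z ζ) * (2 * z - 2 * w * Complex.cosh ζ) *
    Complex.sinh ζ ^ (2 * α)

/-- The second `z`-derivative of `kernel`. -/
def kernelZZ (α : ℕ) (w z ζ : ℂ) : ℂ :=
  (1 / 16 * besselPhi α 2 (chordSq w z ζ) * (2 * z - 2 * w * Complex.cosh ζ) ^ 2 -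
    1 / 2 * besselPhi α 1 (chordSq w z ζ)) * Complex.sinh ζ ^ (2 * α)

/-- The function `sinh^{2α} ζ ∂/∂ζ` of the Bessel factor of `kernel`. -/
def kernelFlux (α : ℕ) (w z ζ : ℂ) : ℂ :=
  z * w / 2 * Complex.sinh ζ ^ (2 * α + 1) * besselPhi α 1 (chordSq w z ζ)

theorem contDiff_besselPhi (ν : ℂ) (k : ℕ) : ContDiff ℂ 1 (besselPhi ν k) :=
  (differentiable_besselPhi ν k).contDiff

theorem contDiff_chordSq (w : ℂ) : ContDiff ℂ 1 (fun x : ℂ × ℂ => chordSq w x.1 x.2) := by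
  unfold chordSq
  fun_prop

theorem contDiff_kernel (α : ℕ) (w : ℂ) : ContDiff ℂ 1 (Function.uncurry (kernel α w)) := by
  have h := (contDiff_besselPhi α 0).comp (contDiff_chordSq w)
  exact h.mul ((Complex.contDiff_sinh.comp contDiff_snd).pow _)

theorem contDiff_kernelZ (α : ℕ) (w : ℂ) : ContDiff ℂ 1 (Function.uncurry (kernelZ α w)) := by
  have h := (contDiff_besselPhi α 1).comp (contDiff_chordSq w)
  refine ((contDiff_const.mul h).mul ?_).mul ((Complex.contDiff_sinh.comp contDiff_snd).pow _)
  fun_prop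

theorem hasDerivAt_chordSq_fst (w z ζ : ℂ) :
    HasDerivAt (fun z => chordSq w z ζ) (2 * z - 2 * w * Complex.cosh ζ) z := by
  convert! ((hasDerivAt_pow 2 z).add_const (w ^ 2)).sub
    ((((hasDerivAt_id z).const_mul 2).mul_const w).mul_const (Complex.cosh ζ)) using 1
  simp

theorem hasDerivAt_chordSq_snd (w z ζ : ℂ) :
    HasDerivAt (chordSq w z) (-(2 * z * w * Complex.sinh ζ)) ζ :=
  ((Complex.hasDerivAt_cosh ζ).const_mul (2 * z * w)).const_sub (z ^ 2 + w ^ 2)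

theorem hasDerivAt_kernel (α : ℕ) (w z ζ : ℂ) :
    HasDerivAt (fun z => kernel α w z ζ) (kernelZ α w z ζ) z :=
  ((hasDerivAt_besselPhi α 0 _).comp z (hasDerivAt_chordSq_fst w z ζ)).mul_const _

theorem hasDerivAt_kernelZ (α : ℕ) (w z ζ : ℂ) :
    HasDerivAt (fun z => kernelZ α w z ζ) (kernelZZ α w z ζ) z := by
  have h1 : HasDerivAt (fun z => 2 * z - 2 * w * Complex.cosh ζ) 2 z := by
    simpa using ((hasDerivAt_id z).const_mul 2).sub_const (2 * w * Complex.cosh ζ)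
  convert! ((((hasDerivAt_besselPhi α 1 _).comp z (hasDerivAt_chordSq_fst w z ζ)).const_mul
    (-(1 / 4))).mul h1).mul_const (Complex.sinh ζ ^ (2 * α)) using 1
  simp only [kernelZZ, Function.comp]
  ring

/-- With `ζ = iθ`, `chordSq` is a squared distance in polar coordinates, and the Bessel factor is a
radial solution of the Helmholtz equation in dimension `2α + 2`. The angular part of the Laplacian,
weighted by `sinh^{2α} ζ`, is the `ζ`-derivative of the flux. -/
theorem hasDerivAt_kernelFlux (α : ℕ) (w : ℂ) {z : ℂ} (hz : z ≠ 0) (ζ : ℂ) :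
    HasDerivAt (kernelFlux α w z) (z ^ 2 * (kernelZZ α w z ζ + (2 * α + 1) / z * kernelZ α w z ζ +
      kernel α w z ζ)) ζ := by
  convert! (((Complex.hasDerivAt_sinh ζ).pow (2 * α + 1)).const_mul (z * w / 2)).mul
    ((hasDerivAt_besselPhi α 1 _).comp ζ (hasDerivAt_chordSq_snd w z ζ)) using 1
  have h := besselPhi_ode α (chordSq w z ζ)
  have h2 := Complex.cosh_sq ζ
  have h3 : chordSq w z ζ = z ^ 2 + w ^ 2 - 2 * z * w * Complex.cosh ζ := rfl
  simp only [kernelZZ, kernelZ, kernel, Function.comp, Nat.add_sub_cancel, pow_succ, Pi.pow_apply]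
  generalize besselPhi α 0 (chordSq w z ζ) = p0 at *
  generalize besselPhi α 1 (chordSq w z ζ) = p1 at *
  generalize besselPhi α 2 (chordSq w z ζ) = p2 at *
  rw [h3] at h
  generalize Complex.cosh ζ = c at *
  generalize Complex.sinh ζ = s at *
  generalize s ^ (2 * α) = r at *
  have hp : p0 = (α + 1) * p1 - (z ^ 2 + w ^ 2 - 2 * z * w * c) / 4 * p2 := by
    linear_combination h
  have hc : s ^ 2 = c ^ 2 - 1 := by linear_combination -h2
  push_cast
  rw [hp]
  field_simp
  ring_nf
  simp only [hc]
  ring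

theorem sinh_log_sub_log {z w : ℂ} (hz : z ≠ 0) (hw : w ≠ 0) :
    Complex.sinh (Complex.log z - Complex.log w) = (z ^ 2 - w ^ 2) / (2 * z * w) := by
  rw [Complex.sinh, neg_sub, Complex.exp_sub, Complex.exp_sub, Complex.exp_log hz,
    Complex.exp_log hw]
  field_simp

theorem cosh_log_sub_log {z w : ℂ} (hz : z ≠ 0) (hw : w ≠ 0) :
    Complex.cosh (Complex.log z - Complex.log w) = (z ^ 2 + w ^ 2) / (2 * z * w) := by
  rw [Complex.cosh, neg_sub, Complex.exp_sub, Complex.exp_sub, Complex.exp_log hz,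
    Complex.exp_log hw]
  field_simp

/-- The integral of `kernel` from `0` to `log z - log w`. -/
def nicholsonIntegral (α : ℕ) (w : ℂ) : ℂ → ℂ :=
  segmentIntegral (kernel α w) fun z => Complex.log z - Complex.log w

/-- The derivative of `nicholsonIntegral`. -/
def nicholsonIntegral' (α : ℕ) (w z : ℂ) : ℂ :=
  segmentIntegral (kernelZ α w) (fun z => Complex.log z - Complex.log w) z +
    1 / z * (besselPhi α 0 0 * ((z ^ 2 - w ^ 2) / (2 * z * w)) ^ (2 * α))

/-- `chordSq` factors as `(z - w e^ζ)(z - w e^{-ζ})`, and `e^ζ = z/w` at the endpoint. -/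
theorem chordSq_log_sub_log {z w : ℂ} (hz : z ≠ 0) (hw : w ≠ 0) :
    chordSq w z (Complex.log z - Complex.log w) = 0 := by
  rw [chordSq, cosh_log_sub_log hz hw]
  field_simp
  ring

theorem hasDerivAt_log_sub_const (w : ℂ) {z : ℂ} (hz : z ∈ Complex.slitPlane) :
    HasDerivAt (fun z => Complex.log z - Complex.log w) (1 / z) z := by
  rw [one_div]
  exact (Complex.hasDerivAt_log hz).sub_const _

theorem continuousOn_one_div_slitPlane :
    ContinuousOn (fun z : ℂ => 1 / z) Complex.slitPlane :=
  continuousOn_const.div continuousOn_id fun _ hz => Complex.slitPlane_ne_zero hz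

theorem hasDerivAt_nicholsonIntegral (α : ℕ) {w z : ℂ} (hw : w ≠ 0) (hz : z ∈ Complex.slitPlane) :
    HasDerivAt (nicholsonIntegral α w) (nicholsonIntegral' α w z) z := by
  have hz0 := Complex.slitPlane_ne_zero hz
  have h := hasDerivAt_segmentIntegral_of_contDiff (contDiff_kernel α w) (hasDerivAt_kernel α w)
    Complex.isOpen_slitPlane (fun _ h => hasDerivAt_log_sub_const w h)
    continuousOn_one_div_slitPlane hz
  rw [kernel, chordSq_log_sub_log hz0 hw, sinh_log_sub_log hz0 hw] at h
  exact h

/-- The Bessel operator under the integral yields the flux between the endpoints, and the flux is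
zero at `ζ = 0`. At the other endpoint the terms with `besselPhi α 1 0` cancel against the endpoint
value of `kernelZ`, so only those with `besselPhi α 0 0` remain. -/
theorem hasDerivAt_nicholsonIntegral' (α : ℕ) {w z : ℂ} (hw : w ≠ 0)
    (hz : z ∈ Complex.slitPlane) :
    HasDerivAt (nicholsonIntegral' α w)
      (-((2 * α + 1) / z * nicholsonIntegral' α w z) - nicholsonIntegral α w z +
        2 * α * besselPhi α 0 0 * ((z ^ 2 - w ^ 2) / (2 * z * w)) ^ (2 * α - 1) / (z * w)) z := by
  have hz0 := Complex.slitPlane_ne_zero hz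
  have h := hasDerivAt_segmentIntegral_of_contDiff (contDiff_kernelZ α w) (hasDerivAt_kernelZ α w)
    Complex.isOpen_slitPlane (fun _ h => hasDerivAt_log_sub_const w h)
    continuousOn_one_div_slitPlane hz
  have hσ : HasDerivAt (fun z => (z ^ 2 - w ^ 2) / (2 * z * w)) ((z ^ 2 + w ^ 2) / (2 * z ^ 2 * w))
      z := by
    convert! ((hasDerivAt_pow 2 z).sub_const (w ^ 2)).div
      (((hasDerivAt_id z).const_mul 2).mul_const w)
      (mul_ne_zero (mul_ne_zero two_ne_zero hz0) hw) using 1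
    simp only [id]
    field_simp
    ring
  have hinv : HasDerivAt (fun z : ℂ => 1 / z) (-(1 / z ^ 2)) z := by
    simpa using hasDerivAt_inv hz0
  have h2 := h.add (hinv.mul ((hσ.pow (2 * α)).const_mul (besselPhi α 0 0)))
  convert! h2 using 1
  set ℓ : ℂ → ℂ := fun z => Complex.log z - Complex.log w with hℓ
  have cφ := fun k => (differentiable_besselPhi α k).continuous
  have hch : Continuous (chordSq w z) := by
    unfold chordSq
    fun_prop
  have c0 : Continuous (kernel α w z) := by
    unfold kernel
    fun_prop
  have cZ : Continuous (kernelZ α w z) := by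
    unfold kernelZ
    fun_prop
  have cZZ : Continuous (kernelZZ α w z) := by
    unfold kernelZZ
    fun_prop
  have hflux := segmentIntegral_deriv (A := kernelFlux α w) (ℓ := ℓ) (z := z)
    (Aζ := fun z ζ => z ^ 2 * (kernelZZ α w z ζ + (2 * α + 1) / z * kernelZ α w z ζ +
      kernel α w z ζ)) (fun ζ => hasDerivAt_kernelFlux α w hz0 ζ)
    (continuous_const.mul ((cZZ.add (continuous_const.mul cZ)).add c0))
  have hsplit : segmentIntegral (fun z ζ => z ^ 2 * (kernelZZ α w z ζ +
      (2 * α + 1) / z * kernelZ α w z ζ + kernel α w z ζ)) ℓ z =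
      z ^ 2 * (segmentIntegral (kernelZZ α w) ℓ z + (2 * α + 1) / z *
        segmentIntegral (kernelZ α w) ℓ z + segmentIntegral (kernel α w) ℓ z) := by
    simp only [segmentIntegral]
    rw [← intervalIntegral.integral_const_mul ((2 * α + 1) / z),
      ← intervalIntegral.integral_add (Continuous.intervalIntegrable (by fun_prop) _ _)
        (Continuous.intervalIntegrable (by fun_prop) _ _),
      ← intervalIntegral.integral_add (Continuous.intervalIntegrable (by fun_prop) _ _)
        (Continuous.intervalIntegrable (by fun_prop) _ _),
      ← intervalIntegral.integral_const_mul]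
    congr 1
    funext t
    ring
  rw [hsplit] at hflux
  simp only [kernelFlux, hℓ, kernelZ, chordSq_log_sub_log hz0 hw, sinh_log_sub_log hz0 hw,
    cosh_log_sub_log hz0 hw, Complex.sinh_zero] at hflux ⊢
  rw [← hℓ] at hflux ⊢
  simp only [nicholsonIntegral', nicholsonIntegral]
  rw [← hℓ]
  generalize segmentIntegral (kernelZZ α w) ℓ z = J2 at *
  generalize segmentIntegral (kernelZ α w) ℓ z = J1 at *
  generalize segmentIntegral (kernel α w) ℓ z = J0 at *
  have hJ : J2 = 1 / z ^ 2 * (z * w / 2 * ((z ^ 2 - w ^ 2) / (2 * z * w)) ^ (2 * α + 1) *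
      besselPhi α 1 0) - (2 * α + 1) / z * J1 - J0 := by
    rw [zero_pow (by omega : 2 * α + 1 ≠ 0)] at hflux
    field_simp
    field_simp at hflux
    linear_combination hflux
  rw [hJ, pow_succ _ (2 * α)]
  simp only [Pi.pow_apply]
  -- For `α = 0` the exponent `2 * α - 1` truncates to `0`, harmlessly, because of the factor `2 *
  -- α`.
  rcases α with _ | k
  · simp
    field_simp
    ring
  · obtain ⟨τ, h1, h2⟩ : ∃ τ, ((z ^ 2 - w ^ 2) / (2 * z * w)) ^ (2 * (k + 1) - 1) = τ ∧
        ((z ^ 2 - w ^ 2) / (2 * z * w)) ^ (2 * (k + 1)) = τ * ((z ^ 2 - w ^ 2) / (2 * z * w)) :=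
      ⟨_, rfl, by rw [← pow_succ]; rfl⟩
    rw [h1, h2]
    push_cast
    field_simp
    ring

/-- The contour integral in Nicholson's formula. -/
theorem contourIntegral_integrand (α : ℕ) (z w : ℂ)
    (γ : Path (0 : ℂ) (Complex.log z - Complex.log w)) (hγ : IsPiecewiseC1 γ) :
    contourIntegral (integrand α z w) γ = Complex.Gamma (α + 1) * nicholsonIntegral α w z := by
  have h : integrand α z w = fun ζ => Complex.Gamma (α + 1) * kernel α w z ζ := by
    funext ζ
    rw [integrand, normBesselJ_eq_besselPhi, Complex.sqrt, Complex.cpow_ofNat_inv_pow, kernel,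
      chordSq, mul_assoc]
  have hc : ContDiff ℂ 1 fun ζ => Complex.Gamma (α + 1) * kernel α w z ζ := by
    have h1 : ContDiff ℂ 1 fun ζ => Function.uncurry (kernel α w) (z, ζ) :=
      (contDiff_kernel α w).comp (by fun_prop)
    exact contDiff_const.mul h1
  rw [h, contourIntegral_eq_segmentIntegral (hc.differentiable one_ne_zero)
    (hc.continuous_deriv le_rfl) γ hγ, nicholsonIntegral, segmentIntegral,
    ← intervalIntegral.integral_const_mul]
  congr 1
  funext t
  ring

theorem nicholsonIntegral_self (α : ℕ) (w : ℂ) : nicholsonIntegral α w w = 0 := by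
  simp [nicholsonIntegral, segmentIntegral]

/-- The power `0 ^ (2 * α)` is `1` for `α = 0` and `0` otherwise; this separates the two cases of
the theorem. -/
theorem nicholsonIntegral'_self (α : ℕ) (w : ℂ) :
    nicholsonIntegral' α w w = 1 / w * (besselPhi α 0 0 * 0 ^ (2 * α)) := by
  simp [nicholsonIntegral', segmentIntegral]

/-! ### The correction terms -/

/-- The polynomials `P_j(a, b)` with `D_s^j Q^p = P_j(Q, z² + w² - s²) Q^{p - j}`, where `Q` is
the quartic. -/
def corrPoly (p a b : ℂ) : ℕ → ℂ
  | 0 => 1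
  | 1 => -4 * p * b
  | j + 2 => -4 * (p - j - 1) * b * corrPoly p a b (j + 1) +
      4 * (j + 1) * (2 * p - j) * a * corrPoly p a b j

/-- The recurrence comes from `Q · D_s Q^p = -4 p b Q^p` with `b = z² + w² - s²`: apply `D_s^{j+1}`
by Leibniz' rule, with `D_s Q = -4b`, `D_s b = -2`, and divide by `Q^{p-j-1}`. -/
theorem corrPoly_add_two (p a b : ℂ) (j : ℕ) : corrPoly p a b (j + 2) =
    -4 * (p - j - 1) * b * corrPoly p a b (j + 1) +
      4 * (j + 1) * (2 * p - j) * a * corrPoly p a b j := rfl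

theorem corrPoly_zero_left (p b : ℂ) (j : ℕ) :
    corrPoly p 0 b j = (∏ i ∈ Finset.range j, (-4 * (p - i))) * b ^ j := by
  induction j using Nat.twoStepInduction with
  | zero => simp [corrPoly]
  | one => simp [corrPoly]
  | more j _ ih =>
    rw [corrPoly_add_two, ih, Finset.prod_range_succ _ (j + 1)]
    push_cast
    ring

theorem continuous_corrPoly (p : ℂ) {X : Type*} [TopologicalSpace X] {a b : X → ℂ}
    (ha : Continuous a) (hb : Continuous b) (j : ℕ) :
    Continuous fun x => corrPoly p (a x) (b x) j := by
  induction j using Nat.twoStepInduction with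
  | zero => exact continuous_const
  | one => exact continuous_const.mul hb
  | more j h0 h1 =>
    simp only [corrPoly_add_two]
    fun_prop

/-- Raising relation for the derivative along `s`. -/
theorem corrPoly_hasDerivAt_real (p z w : ℂ) (s : ℝ) (j : ℕ) :
    ∃ d : ℂ, HasDerivAt (fun s : ℝ => corrPoly p (quartic z w s) (z ^ 2 + w ^ 2 - s ^ 2) j)
        (s * d) s ∧
      quartic z w s * d = corrPoly p (quartic z w s) (z ^ 2 + w ^ 2 - s ^ 2) (j + 1) +
        4 * (p - j) * (z ^ 2 + w ^ 2 - s ^ 2) *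
          corrPoly p (quartic z w s) (z ^ 2 + w ^ 2 - s ^ 2) j := by
  have hb : HasDerivAt (fun s : ℝ => z ^ 2 + w ^ 2 - (s : ℂ) ^ 2) (s * -2) s := by
    convert! ((Complex.ofRealCLM.hasDerivAt (x := s)).pow 2).const_sub (z ^ 2 + w ^ 2) using 1
    simp
    ring
  have ha : HasDerivAt (fun s : ℝ => quartic z w s)
      (s * (-4 * (z ^ 2 + w ^ 2 - (s : ℂ) ^ 2))) s := by
    convert! ((((Complex.ofRealCLM.hasDerivAt (x := s)).pow 2).const_mul 2 |>.mul_const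
      (z ^ 2 + w ^ 2)).const_sub ((z ^ 2 - w ^ 2) ^ 2)).add
      ((Complex.ofRealCLM.hasDerivAt (x := s)).pow 4) using 1
    simp
    ring
  -- The second relation says `D_s (P_j Q^{p-j}) = P_{j+1} Q^{p-j-1}` after clearing the power of
  -- `Q`; `d` stands for `D_s P_j`.
  induction j using Nat.twoStepInduction with
  | zero =>
    refine ⟨0, ?_, ?_⟩
    · simpa [corrPoly] using hasDerivAt_const s (1 : ℂ)
    · simp [corrPoly]
  | one =>
    refine ⟨8 * p, ?_, ?_⟩
    · convert! hb.const_mul (-4 * p) using 1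
      ring
    · simp only [corrPoly]
      push_cast
      ring
  | more j h0 h1 =>
    obtain ⟨d0, hd0, e0⟩ := h0
    obtain ⟨d1, hd1, e1⟩ := h1
    refine ⟨-4 * (p - j - 1) * (-2 * corrPoly p (quartic z w s) (z ^ 2 + w ^ 2 - s ^ 2) (j + 1) +
      (z ^ 2 + w ^ 2 - s ^ 2) * d1) + 4 * (j + 1) * (2 * p - j) *
      (-4 * (z ^ 2 + w ^ 2 - s ^ 2) * corrPoly p (quartic z w s) (z ^ 2 + w ^ 2 - s ^ 2) j +
        quartic z w s * d0), ?_, ?_⟩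
    · convert! ((hb.const_mul (-4 * (p - j - 1))).mul hd1).add
        ((ha.const_mul (4 * ((j : ℂ) + 1) * (2 * p - j))).mul hd0) using 1
      ring
    · rw [corrPoly_add_two] at e1
      rw [corrPoly_add_two _ _ _ (j + 1), corrPoly_add_two]
      push_cast at e1 ⊢
      linear_combination (-4 * (p - j - 1) * (z ^ 2 + w ^ 2 - s ^ 2)) * e1 +
        (4 * (j + 1) * (2 * p - j) * quartic z w s) * e0

/-- Raising relation for the derivative along `z`. -/
theorem corrPoly_hasDerivAt_complex (p w z : ℂ) (j : ℕ) :
    ∃ d : ℂ, HasDerivAt (fun z => corrPoly p ((z ^ 2 - w ^ 2) ^ 2) (z ^ 2 + w ^ 2) j) d z ∧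
      (z ^ 2 - w ^ 2) * (z * d) =
        ((2 * p - j) * (z ^ 2 - w ^ 2) - 4 * z ^ 2 * (p - j)) *
          corrPoly p ((z ^ 2 - w ^ 2) ^ 2) (z ^ 2 + w ^ 2) j -
        1 / 2 * corrPoly p ((z ^ 2 - w ^ 2) ^ 2) (z ^ 2 + w ^ 2) (j + 1) := by
  have hb : HasDerivAt (fun z : ℂ => z ^ 2 + w ^ 2) (2 * z) z := by
    simpa using (hasDerivAt_pow 2 z).add_const (w ^ 2)
  have ha : HasDerivAt (fun z : ℂ => (z ^ 2 - w ^ 2) ^ 2) (4 * z * (z ^ 2 - w ^ 2)) z := by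
    convert! ((hasDerivAt_pow 2 z).sub_const (w ^ 2)).pow 2 using 1
    simp
    ring
  induction j using Nat.twoStepInduction with
  | zero =>
    refine ⟨0, ?_, ?_⟩
    · simpa [corrPoly] using hasDerivAt_const z (1 : ℂ)
    · simp only [corrPoly]
      push_cast
      ring
  | one =>
    refine ⟨-4 * p * (2 * z), hb.const_mul (-4 * p), ?_⟩
    simp only [corrPoly]
    push_cast
    ring
  | more j h0 h1 =>
    obtain ⟨d0, hd0, e0⟩ := h0
    obtain ⟨d1, hd1, e1⟩ := h1
    refine ⟨_, ((hb.const_mul (-4 * (p - j - 1))).mul hd1).add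
        ((ha.const_mul (4 * ((j : ℂ) + 1) * (2 * p - j))).mul hd0), ?_⟩
    rw [corrPoly_add_two] at e1
    rw [corrPoly_add_two _ _ _ (j + 1), corrPoly_add_two]
    push_cast at e1 ⊢
    linear_combination (-4 * (p - j - 1) * (z ^ 2 + w ^ 2)) * e1 +
        (4 * (j + 1) * (2 * p - j) * (z ^ 2 - w ^ 2) ^ 2) * e0

/-! ### The limits of `D_s^j f` at `s = 0`. -/

theorem continuous_quartic (z w : ℂ) : Continuous fun s : ℝ => quartic z w s := by
  unfold quartic
  fun_prop

theorem hasDerivAt_quartic (z w : ℂ) (s : ℝ) : HasDerivAt (fun s : ℝ => quartic z w s)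
    (s * (-4 * (z ^ 2 + w ^ 2 - (s : ℂ) ^ 2))) s := by
  convert! ((((Complex.ofRealCLM.hasDerivAt (x := s)).pow 2).const_mul 2 |>.mul_const
    (z ^ 2 + w ^ 2)).const_sub ((z ^ 2 - w ^ 2) ^ 2)).add
    ((Complex.ofRealCLM.hasDerivAt (x := s)).pow 4) using 1
  simp
  ring

/-- A continuous square root of a differentiable function is differentiable where it does not
vanish. -/
theorem hasDerivAt_of_sq_eq {R Q : ℝ → ℂ} {q : ℂ} {s : ℝ} (hR : ContinuousAt R s)
    (hRQ : ∀ᶠ t in 𝓝 s, R t ^ 2 = Q t) (hQ : HasDerivAt Q q s) (h0 : R s ≠ 0) :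
    HasDerivAt R (q / (2 * R s)) s := by
  rw [hasDerivAt_iff_tendsto_slope] at hQ ⊢
  have hsum : Tendsto (fun t => R t + R s) (𝓝[≠] s) (𝓝 (R s + R s)) :=
    (hR.tendsto.mono_left nhdsWithin_le_nhds).add_const _
  have hne : R s + R s ≠ 0 := by
    rw [← two_mul]
    exact mul_ne_zero two_ne_zero h0
  rw [two_mul]
  refine (hQ.div hsum hne).congr' ?_
  filter_upwards [hsum.eventually_ne hne, hRQ.filter_mono nhdsWithin_le_nhds] with t ht htQ
  rw [Pi.div_apply, slope_def_module, slope_def_module, ← htQ, ← hRQ.self_of_nhds,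
    show R t ^ 2 - R s ^ 2 = (R t - R s) * (R t + R s) by ring, ← smul_mul_assoc,
    mul_div_cancel_right₀ _ ht]

/-- If `z² = w²` then `Q(s) = s² (s² - 4z²)` vanishes at `0`, so the neighbourhood must be
punctured. -/
theorem eventually_quartic_ne_zero {z w : ℂ} (hz : z ≠ 0) :
    ∀ᶠ s : ℝ in 𝓝[≠] (0 : ℝ), quartic z w s ≠ 0 := by
  by_cases h : z ^ 2 - w ^ 2 = 0
  · have hc : Continuous fun s : ℝ => (s : ℂ) ^ 2 - 4 * z ^ 2 := by fun_prop
    have h1 : ∀ᶠ s : ℝ in 𝓝 (0 : ℝ), (s : ℂ) ^ 2 - 4 * z ^ 2 ≠ 0 :=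
      hc.continuousAt.eventually_ne (by simpa using hz)
    filter_upwards [h1.filter_mono nhdsWithin_le_nhds, self_mem_nhdsWithin] with s hs hs0
    have hs0' : (s : ℂ) ≠ 0 := by exact_mod_cast hs0
    have : quartic z w s = s ^ 2 * (s ^ 2 - 4 * z ^ 2) := by
      rw [quartic]
      linear_combination (z ^ 2 - w ^ 2 + 2 * s ^ 2) * h
    rw [this]
    exact mul_ne_zero (pow_ne_zero 2 hs0') hs
  · refine Eventually.filter_mono nhdsWithin_le_nhds ?_
    exact (continuous_quartic z w).continuousAt.eventually_ne (by simpa [quartic] using h)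

theorem eventually_nhds_of_punctured {P : ℝ → Prop} (h : ∀ᶠ s in 𝓝[≠] (0 : ℝ), P s) :
    ∀ᶠ s in 𝓝[≠] (0 : ℝ), ∀ᶠ t in 𝓝 s, P t := by
  filter_upwards [eventually_eventually_nhdsWithin.2 h, self_mem_nhdsWithin] with s hs hs0
  rwa [isOpen_compl_singleton.nhdsWithin_eq hs0] at hs

/-- The iterates of `D_s` on `corrFun`, away from `s = 0`. -/
theorem opD_iterate_corrFun {m : ℕ} {z w : ℂ} (hz : z ≠ 0) {R : ℝ → ℂ}
    (hR : IsSignedRoot z w R) {j : ℕ} (hj : j ≤ m) :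
    ∀ᶠ s in 𝓝[≠] (0 : ℝ), opD^[j] (corrFun (m + 1) z w R) s =
      ((m + 1 : ℕ) : ℂ) / 2 ^ (2 * m) / (z ^ (2 * (m + 1)) * w ^ (2 * (m + 1))) *
        (corrPoly (m + 1 / 2) (quartic z w s) (z ^ 2 + w ^ 2 - s ^ 2) j *
          R s ^ (2 * (m - j) + 1)) := by
  induction j with
  | zero =>
    refine Eventually.of_forall fun s => ?_
    have e1 : 2 * ((m + 1 : ℕ) : ℤ) - 2 = ((2 * m : ℕ) : ℤ) := by push_cast; ring
    have e2 : 2 * ((m + 1 : ℕ) : ℤ) - 1 = ((2 * (m - 0) + 1 : ℕ) : ℤ) := by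
      rw [Nat.sub_zero]
      push_cast
      ring
    simp only [Function.iterate_zero, id, corrFun, corrPoly]
    rw [e1, e2, zpow_natCast, zpow_natCast]
    ring
  | succ j ih =>
    have ih := ih (by omega)
    filter_upwards [eventually_nhds_of_punctured ih, self_mem_nhdsWithin,
      eventually_nhds_of_punctured (hR.sq_eq.filter_mono nhdsWithin_le_nhds),
      hR.continuousAt.filter_mono nhdsWithin_le_nhds, eventually_quartic_ne_zero (w := w) hz]
      with s hs hs0 hsq hcont hQ
    have hs0' : (s : ℂ) ≠ 0 := by exact_mod_cast hs0
    have hRs : R s ≠ 0 := fun h => hQ (by rw [← hsq.self_of_nhds, h]; simp)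
    have hRd := hasDerivAt_of_sq_eq hcont hsq (hasDerivAt_quartic z w s) hRs
    obtain ⟨d, hd, he⟩ := corrPoly_hasDerivAt_real (m + 1 / 2) z w s j
    -- This removes the truncated subtractions from the exponents of `R`.
    obtain ⟨k, rfl⟩ : ∃ k, m = j + 1 + k := ⟨m - (j + 1), by omega⟩
    have hder := ((hd.mul (hRd.pow (2 * (j + 1 + k - j) + 1))).const_mul
      (((j + 1 + k + 1 : ℕ) : ℂ) / 2 ^ (2 * (j + 1 + k)) / (z ^ (2 * (j + 1 + k + 1)) *
        w ^ (2 * (j + 1 + k + 1))))).congr_of_eventuallyEq hs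
    rw [Function.iterate_succ_apply', opD, hder.deriv]
    have e1 : j + 1 + k - j = k + 1 := by omega
    have e2 : j + 1 + k - (j + 1) = k := by omega
    rw [e1, e2]
    rw [← hsq.self_of_nhds] at he ⊢
    generalize ((j + 1 + k + 1 : ℕ) : ℂ) / 2 ^ (2 * (j + 1 + k)) / (z ^ (2 * (j + 1 + k + 1)) *
        w ^ (2 * (j + 1 + k + 1))) = c
    have e3 : corrPoly (((j + 1 + k : ℕ) : ℂ) + 1 / 2) (R s ^ 2) (z ^ 2 + w ^ 2 - s ^ 2) (j + 1) =
      R s ^ 2 * d - 4 * (((j + 1 + k : ℕ) : ℂ) + 1 / 2 - j) * (z ^ 2 + w ^ 2 - s ^ 2) *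
          corrPoly (((j + 1 + k : ℕ) : ℂ) + 1 / 2) (R s ^ 2) (z ^ 2 + w ^ 2 - s ^ 2) j := by
      linear_combination -he
    rw [e3]
    simp only [Pi.pow_apply, Nat.add_sub_cancel, show 2 * (k + 1) = 2 * k + 1 + 1 by ring,
      pow_succ _ (2 * k + 1 + 1), pow_succ _ (2 * k + 1)]
    generalize R s ^ (2 * k + 1) = τ
    push_cast
    field_simp
    ring

/-- For `j ≤ m` the power of `R` in the closed form is positive, so the form is continuous at `0`
even when `R 0 = 0`. -/
theorem tendsto_opD_iterate_corrFun {m : ℕ} {z w : ℂ} (hz : z ≠ 0) {R : ℝ → ℂ}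
    (hR : IsSignedRoot z w R) {j : ℕ} (hj : j ≤ m) :
    Tendsto (opD^[j] (corrFun (m + 1) z w R)) (𝓝[≠] (0 : ℝ))
      (𝓝 (((m + 1 : ℕ) : ℂ) / 2 ^ (2 * m) / (z ^ (2 * (m + 1)) * w ^ (2 * (m + 1))) *
        (corrPoly (m + 1 / 2) ((z ^ 2 - w ^ 2) ^ 2) (z ^ 2 + w ^ 2) j *
          (z ^ 2 - w ^ 2) ^ (2 * (m - j) + 1)))) := by
  refine Tendsto.congr' ((opD_iterate_corrFun hz hR hj).mono fun s hs => hs.symm) ?_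
  have h1 : ContinuousAt (fun s : ℝ => corrPoly ((m : ℂ) + 1 / 2) (quartic z w s)
      (z ^ 2 + w ^ 2 - s ^ 2) j) 0 :=
    (continuous_corrPoly _ (continuous_quartic z w) (by fun_prop) j).continuousAt
  have h2 := (h1.mul (hR.continuousAt.self_of_nhds.pow (2 * (m - j) + 1))).const_mul
    (((m + 1 : ℕ) : ℂ) / 2 ^ (2 * m) / (z ^ (2 * (m + 1)) * w ^ (2 * (m + 1))))
  have h3 := h2.tendsto.mono_left (nhdsWithin_le_nhds (s := {0}ᶜ))
  simpa [quartic, hR.map_zero] using! h3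

/-! ### The correction terms as functions of `z`. -/

/-- The function `z^{-2(m+1)} D_s^j Q^{m+1/2}` at `s = 0`. -/
def corrTerm (m : ℕ) (w : ℂ) (j : ℕ) (z : ℂ) : ℂ :=
  (z ^ (2 * (m + 1)))⁻¹ * (corrPoly (m + 1 / 2) ((z ^ 2 - w ^ 2) ^ 2) (z ^ 2 + w ^ 2) j *
    (z ^ 2 - w ^ 2) ^ (2 * (m - j : ℤ) + 1))

/-- The derivative of `corrTerm`. -/
def corrTerm' (m : ℕ) (w : ℂ) (j : ℕ) (z : ℂ) : ℂ :=
  1 / z * (-(j + 1) * corrTerm m w j z - (z ^ 2 - w ^ 2) / 2 * corrTerm m w (j + 1) z)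

theorem corrTerm_recurrence (m : ℕ) {w z : ℂ} (hδ : z ^ 2 - w ^ 2 ≠ 0) (j : ℕ) :
    (z ^ 2 - w ^ 2) ^ 2 * corrTerm m w (j + 2) z =
      -4 * (m + 1 / 2 - j - 1) * (z ^ 2 + w ^ 2) * corrTerm m w (j + 1) z +
      4 * (j + 1) * (2 * m + 1 - j) * corrTerm m w j z := by
  simp only [corrTerm, corrPoly_add_two]
  generalize z ^ 2 - w ^ 2 = δ at *
  have e1 : δ ^ (2 * ((m : ℤ) - (j + 1 : ℕ)) + 1) =
      δ ^ (2 * ((m : ℤ) - (j + 2 : ℕ)) + 1) * δ ^ 2 := by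
    rw [← zpow_natCast, ← zpow_add₀ hδ]
    congr 1
    push_cast
    ring
  have e2 : δ ^ (2 * ((m : ℤ) - j) + 1) = δ ^ (2 * ((m : ℤ) - (j + 2 : ℕ)) + 1) * δ ^ 4 := by
    rw [← zpow_natCast, ← zpow_add₀ hδ]
    congr 1
    push_cast
    ring
  rw [e1, e2]
  ring

theorem hasDerivAt_corrTerm (m : ℕ) {w z : ℂ} (hz : z ≠ 0) (hδ : z ^ 2 - w ^ 2 ≠ 0) (j : ℕ) :
    HasDerivAt (corrTerm m w j) (corrTerm' m w j z) z := by
  obtain ⟨d, hd, he⟩ := corrPoly_hasDerivAt_complex (m + 1 / 2) w z j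
  have hδd : HasDerivAt (fun z : ℂ => z ^ 2 - w ^ 2) (2 * z) z := by
    simpa using (hasDerivAt_pow 2 z).sub_const (w ^ 2)
  convert! (hasDerivAt_inv_pow (2 * (m + 1)) hz).mul
    (hd.mul ((hasDerivAt_zpow (2 * (m - j : ℤ) + 1) _ (Or.inl hδ)).comp z hδd)) using 1
  simp only [corrTerm', corrTerm, Function.comp, Pi.mul_apply]
  have e3 : corrPoly ((m : ℂ) + 1 / 2) ((z ^ 2 - w ^ 2) ^ 2) (z ^ 2 + w ^ 2) (j + 1) =
      2 * (((2 * (m + 1 / 2) - j) * (z ^ 2 - w ^ 2) - 4 * z ^ 2 * (m + 1 / 2 - j)) *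
          corrPoly (m + 1 / 2) ((z ^ 2 - w ^ 2) ^ 2) (z ^ 2 + w ^ 2) j -
        (z ^ 2 - w ^ 2) * (z * d)) := by
    linear_combination 2 * he
  rw [e3]
  generalize corrPoly ((m : ℂ) + 1 / 2) ((z ^ 2 - w ^ 2) ^ 2) (z ^ 2 + w ^ 2) j = P
  generalize z ^ 2 - w ^ 2 = δ at *
  have e1 : δ ^ (2 * ((m : ℤ) - (j + 1 : ℕ)) + 1) = δ ^ (2 * ((m : ℤ) - j) + 1) * (δ ^ 2)⁻¹ := by
    rw [← zpow_natCast, ← zpow_neg, ← zpow_add₀ hδ]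
    congr 1
    push_cast
    ring
  have e2 : δ ^ (2 * ((m : ℤ) - j) + 1 - 1) = δ ^ (2 * ((m : ℤ) - j) + 1) * δ⁻¹ := by
    rw [zpow_sub_one₀ hδ]
  rw [e1, e2]
  generalize δ ^ (2 * ((m : ℤ) - j) + 1) = τ
  generalize (z ^ (2 * (m + 1)))⁻¹ = q
  push_cast
  field_simp
  ring

/-- The first-order relation between consecutive terms is used twice, and `corrTerm_recurrence`
eliminates the term of index `j + 2`. -/
theorem hasDerivAt_corrTerm' (m : ℕ) {w z : ℂ} (hz : z ≠ 0) (hδ : z ^ 2 - w ^ 2 ≠ 0) (j : ℕ) :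
    HasDerivAt (corrTerm' m w j) (-((2 * (m + 1) + 1) / z * corrTerm' m w j z) -
      2 * (m - j) * corrTerm m w (j + 1) z) z := by
  have hinv : HasDerivAt (fun z : ℂ => 1 / z) (-(1 / z ^ 2)) z := by
    simpa using hasDerivAt_inv hz
  have hδd : HasDerivAt (fun z : ℂ => (z ^ 2 - w ^ 2) / 2) z z := by
    simpa using ((hasDerivAt_pow 2 z).sub_const (w ^ 2)).div_const 2
  convert! hinv.mul (((hasDerivAt_corrTerm m hz hδ j).const_mul (-((j : ℂ) + 1))).sub
    (hδd.mul (hasDerivAt_corrTerm m hz hδ (j + 1)))) using 1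
  have h := corrTerm_recurrence m hδ j
  simp only [corrTerm', Pi.mul_apply, Pi.sub_apply]
  push_cast
  field_simp
  linear_combination (-1 : ℂ) * h

/-- The sum of the correction terms, up to the factor `α / (2^{2α-2} w^{2α})`. -/
def corrSum (m : ℕ) (w z : ℂ) : ℂ :=
  ∑ j ∈ Finset.range (m + 1), coeffA (m + 1) j * ((z ^ (2 * (m + 1)))⁻¹ *
    (corrPoly (m + 1 / 2) ((z ^ 2 - w ^ 2) ^ 2) (z ^ 2 + w ^ 2) j *
      (z ^ 2 - w ^ 2) ^ (2 * (m - j) + 1)))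

theorem corrSum_eq_sum_corrTerm (m : ℕ) (w z : ℂ) :
    corrSum m w z = ∑ j ∈ Finset.range (m + 1), coeffA (m + 1) j * corrTerm m w j z := by
  refine Finset.sum_congr rfl fun j hj => ?_
  have hj := Finset.mem_range.1 hj
  have e : 2 * ((m : ℤ) - j) + 1 = ((2 * (m - j) + 1 : ℕ) : ℤ) := by
    push_cast [Nat.cast_sub (by omega : j ≤ m)]
    ring
  rw [corrTerm, e, zpow_natCast]

theorem differentiableAt_corrPoly (p w z : ℂ) (j : ℕ) :
    DifferentiableAt ℂ (fun z => corrPoly p ((z ^ 2 - w ^ 2) ^ 2) (z ^ 2 + w ^ 2) j) z := by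
  obtain ⟨d, hd, -⟩ := corrPoly_hasDerivAt_complex p w z j
  exact hd.differentiableAt

theorem differentiableAt_corrSum (m : ℕ) (w : ℂ) {z : ℂ} (hz : z ≠ 0) :
    DifferentiableAt ℂ (corrSum m w) z := by
  refine DifferentiableAt.fun_sum fun j _ => ?_
  refine (DifferentiableAt.mul ?_ ?_).const_mul _
  · exact (hasDerivAt_inv_pow _ hz).differentiableAt
  · exact (differentiableAt_corrPoly _ w z j).mul (by fun_prop)

theorem corrSum_self (m : ℕ) (w : ℂ) : corrSum m w w = 0 := by
  simp [corrSum]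

/-- A factor `z² - w²` splits off. In the cofactor at `z = w` only the term `j = m` is left, with
its polynomial evaluated by `corrPoly_zero_left`. -/
theorem hasDerivAt_corrSum_self (m : ℕ) {w : ℂ} (hw : w ≠ 0) :
    HasDerivAt (corrSum m w) (2 * w * (coeffA (m + 1) m * ((w ^ (2 * (m + 1)))⁻¹ *
      ((∏ i ∈ Finset.range m, (-4 * ((m : ℂ) + 1 / 2 - i))) * (2 * w ^ 2) ^ m)))) w := by
  have hδ : HasDerivAt (fun z : ℂ => z ^ 2 - w ^ 2) (2 * w) w := by
    simpa using (hasDerivAt_pow 2 w).sub_const (w ^ 2)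
  have hG : DifferentiableAt ℂ (fun z : ℂ => ∑ j ∈ Finset.range (m + 1),
      coeffA (m + 1) j * ((z ^ (2 * (m + 1)))⁻¹ *
        (corrPoly (m + 1 / 2) ((z ^ 2 - w ^ 2) ^ 2) (z ^ 2 + w ^ 2) j *
          (z ^ 2 - w ^ 2) ^ (2 * (m - j))))) w := by
    refine DifferentiableAt.fun_sum fun j _ => ?_
    refine (DifferentiableAt.mul ?_ ?_).const_mul _
    · exact (hasDerivAt_inv_pow _ hw).differentiableAt
    · exact (differentiableAt_corrPoly _ w w j).mul (by fun_prop)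
  convert! hδ.mul hG.hasDerivAt using 1
  · funext z
    simp only [corrSum, Pi.mul_apply, Finset.mul_sum]
    refine Finset.sum_congr rfl fun j _ => ?_
    ring
  · rw [Finset.sum_range_succ, Finset.sum_eq_zero]
    · simp only [sub_self, zero_mul, add_zero, Nat.sub_self, mul_zero, pow_zero, mul_one, zero_add,
        zero_pow two_ne_zero, corrPoly_zero_left, ← two_mul]
    · intro j hj
      have hj := Finset.mem_range.1 hj
      rw [sub_self, zero_pow (by omega : 2 * (m - j) ≠ 0)]
      simp

/-- At `j = m` the right-hand side is zero; this closes the telescoping sum in `corrSum_ode`. -/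
theorem coeffA_succ (m j : ℕ) : coeffA (m + 1) (j + 1) = 2 * (m - j) * coeffA (m + 1) j := by
  rw [coeffA]
  push_cast
  ring

theorem coeffA_ne_zero {m j : ℕ} (h : j ≤ m) : coeffA (m + 1) j ≠ 0 := by
  induction j with
  | zero => simp [coeffA]
  | succ j ih =>
    rw [coeffA_succ]
    refine mul_ne_zero (mul_ne_zero two_ne_zero (sub_ne_zero.2 ?_)) (ih (by omega))
    exact_mod_cast (by omega : m ≠ j)

/-- The inhomogeneous Bessel equation satisfied by the correction terms. -/
theorem corrSum_ode (m : ℕ) {w z : ℂ} (hz : z ≠ 0) (hδ : z ^ 2 - w ^ 2 ≠ 0) :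
    HasDerivAt (deriv (corrSum m w)) (-((2 * (m + 1) + 1) / z * deriv (corrSum m w) z) -
      corrSum m w z + (z ^ (2 * (m + 1)))⁻¹ * (z ^ 2 - w ^ 2) ^ (2 * m + 1)) z := by
  have hev : ∀ᶠ y in 𝓝 z, y ≠ 0 ∧ y ^ 2 - w ^ 2 ≠ 0 := by
    refine (isOpen_ne.eventually_mem hz).and ?_
    exact (by fun_prop : ContinuousAt (fun y : ℂ => y ^ 2 - w ^ 2) z).eventually_ne hδ
  have h1 : ∀ y : ℂ, y ≠ 0 → y ^ 2 - w ^ 2 ≠ 0 → deriv (corrSum m w) y =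
      ∑ j ∈ Finset.range (m + 1), coeffA (m + 1) j * corrTerm' m w j y := fun y hy hy' => by
    rw [funext (corrSum_eq_sum_corrTerm m w)]
    exact (HasDerivAt.fun_sum fun j _ => (hasDerivAt_corrTerm m hy hy' j).const_mul _).deriv
  have h2 : HasDerivAt (fun y => ∑ j ∈ Finset.range (m + 1), coeffA (m + 1) j * corrTerm' m w j y)
      (∑ j ∈ Finset.range (m + 1), coeffA (m + 1) j * (-((2 * (m + 1) + 1) / z *
        corrTerm' m w j z) - 2 * (m - j) * corrTerm m w (j + 1) z)) z :=
    HasDerivAt.fun_sum fun j _ => (hasDerivAt_corrTerm' m hz hδ j).const_mul _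
  have h3 := h2.congr_of_eventuallyEq (hev.mono fun y hy => h1 y hy.1 hy.2)
  convert! h3 using 1
  have h4 : ∑ j ∈ Finset.range (m + 1), coeffA (m + 1) (j + 1) * corrTerm m w (j + 1) z =
      corrSum m w z - (z ^ (2 * (m + 1)))⁻¹ * (z ^ 2 - w ^ 2) ^ (2 * m + 1) := by
    have h5 := Finset.sum_range_succ' (fun j => coeffA (m + 1) j * corrTerm m w j z) (m + 1)
    rw [Finset.sum_range_succ, ← corrSum_eq_sum_corrTerm, coeffA_succ, sub_self] at h5
    have h6 : coeffA (m + 1) 0 * corrTerm m w 0 z =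
        (z ^ (2 * (m + 1)))⁻¹ * (z ^ 2 - w ^ 2) ^ (2 * m + 1) := by
      have e : 2 * ((m : ℤ) - (0 : ℕ)) + 1 = ((2 * m + 1 : ℕ) : ℤ) := by push_cast; ring
      rw [corrTerm, e, zpow_natCast]
      simp [coeffA, corrPoly]
    rw [h6] at h5
    linear_combination -h5
  rw [h1 z hz hδ, Finset.mul_sum]
  have h7 : ∀ j ∈ Finset.range (m + 1), coeffA (m + 1) j * (-((2 * (m + 1) + 1) / z *
        corrTerm' m w j z) - 2 * (m - j) * corrTerm m w (j + 1) z) =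
      -((2 * (m + 1) + 1) / z * (coeffA (m + 1) j * corrTerm' m w j z)) -
        coeffA (m + 1) (j + 1) * corrTerm m w (j + 1) z := fun j _ => by
    rw [coeffA_succ]
    ring
  rw [Finset.sum_congr rfl h7, Finset.sum_sub_distrib, Finset.sum_neg_distrib, h4]
  ring

/-! ### Solutions of the Bessel equation vanishing at a point -/

/-- A function that solves the Bessel equation off the zeros of `z² - w²` has a constant
Wronskian with every solution. -/
theorem wronskian_eq_of_solvesBesselAt {α : ℕ} {w : ℂ} (hw : w ∈ Complex.slitPlane)
    {F v v' : ℂ → ℂ} (hF : DifferentiableOn ℂ F Complex.slitPlane)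
    (hFs : ∀ z ∈ Complex.slitPlane, z ^ 2 - w ^ 2 ≠ 0 → SolvesBesselAt α F (deriv F) z)
    (hv : ∀ z ∈ Complex.slitPlane, SolvesBesselAt α v v' z) {z : ℂ}
    (hz : z ∈ Complex.slitPlane) :
    wronskian α F (deriv F) v v' z = wronskian α F (deriv F) v v' w := by
  have hW : DifferentiableOn ℂ (wronskian α F (deriv F) v v') Complex.slitPlane := by
    have d1 : DifferentiableOn ℂ v Complex.slitPlane := fun x hx =>
      (hv x hx).1.differentiableAt.differentiableWithinAt
    have d2 : DifferentiableOn ℂ v' Complex.slitPlane := fun x hx =>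
      (hv x hx).2.differentiableAt.differentiableWithinAt
    have d3 := hF.deriv Complex.isOpen_slitPlane
    exact (by fun_prop : Differentiable ℂ fun x : ℂ => x ^ (2 * α + 1)).differentiableOn.mul
      ((hF.mul d2).sub (d3.mul d1))
  have h0 : ∀ x ∈ Complex.slitPlane, x ^ 2 - w ^ 2 ≠ 0 →
      deriv (wronskian α F (deriv F) v v') x = 0 := fun x hx hδ =>
    ((hFs x hx hδ).hasDerivAt_wronskian (Complex.slitPlane_ne_zero hx) (hv x hx)).deriv
  refine Complex.isOpen_slitPlane.is_const_of_deriv_eq_zero isPreconnected_slitPlane hW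
    (fun x hx => ?_) hz hw
  -- The zeros of `x² - w²` are isolated, and the derivative of the Wronskian is continuous, so its
  -- vanishing extends to them.
  by_cases hδ : x ^ 2 - w ^ 2 = 0
  · have hx0 := Complex.slitPlane_ne_zero hx
    have hcont := ((hW.deriv Complex.isOpen_slitPlane).differentiableAt
      (Complex.isOpen_slitPlane.mem_nhds hx)).continuousAt.tendsto.mono_left
      (nhdsWithin_le_nhds (s := {x}ᶜ))
    refine tendsto_nhds_unique hcont (tendsto_const_nhds.congr' ?_)
    have hne : ∀ᶠ y in 𝓝[≠] x, y + x ≠ 0 := by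
      refine Eventually.filter_mono nhdsWithin_le_nhds
        ((by fun_prop : ContinuousAt (fun y : ℂ => y + x) x).eventually_ne ?_)
      rw [← two_mul]
      exact mul_ne_zero two_ne_zero hx0
    filter_upwards [hne, self_mem_nhdsWithin,
      (Complex.isOpen_slitPlane.mem_nhds hx : _ ∈ 𝓝 x) |> mem_nhdsWithin_of_mem_nhds]
      with y hy hyx hys
    refine (h0 y hys fun h => ?_).symm
    have h1 : (y - x) * (y + x) = 0 := by linear_combination h - hδ
    exact mul_ne_zero (sub_ne_zero.2 hyx) hy h1
  · exact h0 x hx hδ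

/-- A solution of the Bessel equation on the slit plane that vanishes at `w` is a multiple of
`j_α(z) y_α(w) - y_α(z) j_α(w)`. -/
theorem eq_of_solvesBesselAt {α : ℕ} {w : ℂ} (hw : w ∈ Complex.slitPlane)
    {F : ℂ → ℂ} (hF : DifferentiableOn ℂ F Complex.slitPlane)
    (hFs : ∀ z ∈ Complex.slitPlane, z ^ 2 - w ^ 2 ≠ 0 → SolvesBesselAt α F (deriv F) z)
    (hF0 : F w = 0) {z : ℂ} (hz : z ∈ Complex.slitPlane) :
    F z = -(w ^ (2 * α + 1) * deriv F w) /
        wronskian α (normBesselJ α) (normBesselJ' α) (normBesselY α) (normBesselY' α) 1 *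
      (normBesselJ α z * normBesselY α w - normBesselY α z * normBesselJ α w) := by
  have hJ := fun z (hz : z ∈ Complex.slitPlane) =>
    solvesBesselAt_normBesselJ α (Complex.slitPlane_ne_zero hz)
  have hY := fun z (hz : z ∈ Complex.slitPlane) => solvesBesselAt_normBesselY α hz
  have h1 := wronskian_eq_of_solvesBesselAt hw hF hFs hJ hz
  have h2 := wronskian_eq_of_solvesBesselAt hw hF hFs hY hz
  have hne := wronskian_normBessel_ne_zero α Complex.one_mem_slitPlane
  have h3 : wronskian α (normBesselJ α) (normBesselJ' α) (normBesselY α) (normBesselY' α) z =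
      wronskian α (normBesselJ α) (normBesselJ' α) (normBesselY α) (normBesselY' α) 1 :=
    Complex.isOpen_slitPlane.is_const_of_deriv_eq_zero isPreconnected_slitPlane
      (fun t ht => ((hJ t ht).hasDerivAt_wronskian (Complex.slitPlane_ne_zero ht)
        (hY t ht)).differentiableAt.differentiableWithinAt)
      (fun t ht => ((hJ t ht).hasDerivAt_wronskian (Complex.slitPlane_ne_zero ht)
        (hY t ht)).deriv) hz Complex.one_mem_slitPlane
  rw [div_mul_eq_mul_div, eq_div_iff hne, ← h3]
  simp only [wronskian, hF0] at h1 h2 ⊢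
  -- Since `F w = 0`, both Wronskians at `w` involve only `deriv F w`; this combination eliminates
  -- `deriv F z`.
  linear_combination normBesselJ α z * h2 - normBesselY α z * h1

/-! ### The left-hand side of the formula as a solution of the Bessel equation. -/

theorem gamma_mul_besselPhi_zero (α : ℕ) :
    Complex.Gamma (α + 1) * besselPhi α 0 0 = 1 := by
  have hN : Complex.Gamma (α + 1) ≠ 0 := by
    rw [Complex.Gamma_nat_eq_factorial]
    exact_mod_cast α.factorial_ne_zero
  rw [besselPhi, expSeries_zero, gammaCoeff, recipGamma]
  simpa using mul_inv_cancel₀ hN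

/-- The left-hand side of Nicholson's formula for `α = m + 1`, as a function of `z`. -/
def nicholsonDiff (m : ℕ) (w z : ℂ) : ℂ :=
  Complex.Gamma ((m + 1 : ℕ) + 1) * nicholsonIntegral (m + 1) w z -
    ((m + 1 : ℕ) : ℂ) / 2 ^ (2 * m) / w ^ (2 * (m + 1)) * corrSum m w z

theorem hasDerivAt_nicholsonDiff (m : ℕ) {w z : ℂ} (hw : w ≠ 0) (hz : z ∈ Complex.slitPlane) :
    HasDerivAt (nicholsonDiff m w) (Complex.Gamma ((m + 1 : ℕ) + 1) *
      nicholsonIntegral' (m + 1) w z - ((m + 1 : ℕ) : ℂ) / 2 ^ (2 * m) / w ^ (2 * (m + 1)) *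
        deriv (corrSum m w) z) z :=
  ((hasDerivAt_nicholsonIntegral (m + 1) hw hz).const_mul _).sub
    ((differentiableAt_corrSum m w (Complex.slitPlane_ne_zero hz)).hasDerivAt.const_mul _)

/-- The inhomogeneities of the integral and of the correction sum agree, by `Γ(α+1) besselPhi α 0 0
= 1` and the identity `hpow`. -/
theorem solvesBesselAt_nicholsonDiff (m : ℕ) {w z : ℂ} (hw : w ≠ 0) (hz : z ∈ Complex.slitPlane)
    (hδ : z ^ 2 - w ^ 2 ≠ 0) :
    SolvesBesselAt (m + 1) (nicholsonDiff m w) (deriv (nicholsonDiff m w)) z := by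
  have hz0 := Complex.slitPlane_ne_zero hz
  have h1 := hasDerivAt_nicholsonDiff m hw hz
  refine ⟨h1.differentiableAt.hasDerivAt, ?_⟩
  have h2 := (((hasDerivAt_nicholsonIntegral' (m + 1) hw hz).const_mul
    (Complex.Gamma ((m + 1 : ℕ) + 1))).sub ((corrSum_ode m hz0 hδ).const_mul
      (((m + 1 : ℕ) : ℂ) / 2 ^ (2 * m) / w ^ (2 * (m + 1))))).congr_of_eventuallyEq
    ((Complex.isOpen_slitPlane.eventually_mem hz).mono fun y hy =>
      (hasDerivAt_nicholsonDiff m hw hy).deriv)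
  convert! h2 using 1
  rw [h1.deriv, nicholsonDiff]
  have hg := gamma_mul_besselPhi_zero (m + 1)
  have e : 2 * (m + 1) - 1 = 2 * m + 1 := by omega
  have hpow : ((z ^ 2 - w ^ 2) / (2 * z * w)) ^ (2 * m + 1) / (z * w) * 2 =
      1 / 2 ^ (2 * m) / w ^ (2 * (m + 1)) * ((z ^ 2 - w ^ 2) ^ (2 * m + 1) /
        z ^ (2 * (m + 1))) := by
    rw [div_pow, mul_pow, mul_pow, show 2 * (m + 1) = 2 * m + 1 + 1 by ring, pow_succ _ (2 * m + 1),
      pow_succ _ (2 * m + 1), pow_succ 2 (2 * m)]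
    field_simp
  rw [e]
  push_cast at hg ⊢
  linear_combination (-(2 * ((m : ℂ) + 1)) * ((z ^ 2 - w ^ 2) / (2 * z * w)) ^ (2 * m + 1) /
    (z * w)) * hg - ((m : ℂ) + 1) * hpow

/-- The normalized derivative of `nicholsonDiff m w` at `w`. -/
def nicholsonSlope (m : ℕ) : ℂ :=
  -(((m + 1 : ℕ) : ℂ) / 2 ^ (2 * m) * 2 ^ (m + 1) * coeffA (m + 1) m *
    ∏ i ∈ Finset.range m, (-4 * ((m : ℂ) + 1 / 2 - i)))

theorem nicholsonSlope_ne_zero (m : ℕ) : nicholsonSlope m ≠ 0 := by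
  have h2 : (2 : ℂ) ≠ 0 := two_ne_zero
  refine neg_ne_zero.2 (mul_ne_zero (mul_ne_zero (mul_ne_zero (div_ne_zero
    (Nat.cast_ne_zero.2 m.succ_ne_zero) (pow_ne_zero _ h2)) (pow_ne_zero _ h2))
    (coeffA_ne_zero le_rfl)) (Finset.prod_ne_zero_iff.2 fun i hi => ?_))
  refine mul_ne_zero (by norm_num) fun h => ?_
  have hi := Finset.mem_range.1 hi
  -- A vanishing factor `m + 1/2 - i` would make an odd number even.
  have h1 : ((2 * m + 1 : ℕ) : ℂ) = ((2 * i : ℕ) : ℂ) := by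
    push_cast
    linear_combination 2 * h
  have h3 : 2 * m + 1 = 2 * i := by exact_mod_cast h1
  omega

/-- The integral contributes nothing to the derivative at `w` because `2(m+1) > 0`; in the
contribution of the correction sum all powers of `w` cancel. -/
theorem deriv_nicholsonDiff_self (m : ℕ) {w : ℂ} (hw : w ∈ Complex.slitPlane) :
    w ^ (2 * (m + 1) + 1) * deriv (nicholsonDiff m w) w = nicholsonSlope m := by
  have hw0 := Complex.slitPlane_ne_zero hw
  rw [(hasDerivAt_nicholsonDiff m hw0 hw).deriv, nicholsonIntegral'_self,
    (hasDerivAt_corrSum_self m hw0).deriv, zero_pow (by omega : 2 * (m + 1) ≠ 0), nicholsonSlope,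
    mul_pow, ← pow_mul]
  generalize ∏ i ∈ Finset.range m, (-4 * ((m : ℂ) + 1 / 2 - i)) = c
  generalize coeffA (m + 1) m = a
  push_cast
  field_simp
  ring

end Nicholson

end

open Nicholson in
theorem theorem2p4 (α : ℕ) :
    ∃ C : ℂ, C ≠ 0 ∧
      ∀ z ∈ Complex.slitPlane, ∀ w ∈ Complex.slitPlane, z ≠ w →
        ∀ γ : Path (0 : ℂ) (Complex.log z - Complex.log w), Nicholson.IsPiecewiseC1 γ →
        ∀ R : ℝ → ℂ, Nicholson.IsSignedRoot z w R →
          (∀ j < α, Tendsto (Nicholson.opD^[j] (Nicholson.corrFun α z w R)) (𝓝[≠] (0 : ℝ))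
            (𝓝 (Nicholson.opDAtZero j (Nicholson.corrFun α z w R)))) ∧
          Nicholson.contourIntegral (Nicholson.integrand α z w) γ -
              ∑ j ∈ Finset.range α,
                Nicholson.coeffA α j * Nicholson.opDAtZero j (Nicholson.corrFun α z w R) =
            C * (Nicholson.normBesselJ α z * Nicholson.normBesselY α w -
              Nicholson.normBesselY α z * Nicholson.normBesselJ α w) := by
  have hW := wronskian_normBessel_ne_zero α Complex.one_mem_slitPlane
  rcases α with _ | m
  -- For `α = 0` the integral alone solves the homogeneous equation; its derivative at `w` is `1 /
  -- w`, hence the numerator `-1`.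
  · refine ⟨-1 / wronskian 0 (normBesselJ 0) (normBesselJ' 0) (normBesselY 0) (normBesselY' 0) 1,
      div_ne_zero (neg_ne_zero.2 one_ne_zero) hW, fun z hz w hw _ γ hγ R _ => ⟨by simp, ?_⟩⟩
    have hw0 := Complex.slitPlane_ne_zero hw
    have hd := fun z (hz : z ∈ Complex.slitPlane) =>
      (hasDerivAt_nicholsonIntegral 0 hw0 hz).const_mul (Complex.Gamma ((0 : ℕ) + 1))
    have hsol := eq_of_solvesBesselAt (α := 0) hw
      (F := fun z => Complex.Gamma ((0 : ℕ) + 1) * nicholsonIntegral 0 w z)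
      (fun z hz => (hd z hz).differentiableAt.differentiableWithinAt)
      (fun z hz _ => by
        refine ⟨(hd z hz).differentiableAt.hasDerivAt, ?_⟩
        have h2 := ((hasDerivAt_nicholsonIntegral' 0 hw0 hz).const_mul
          (Complex.Gamma ((0 : ℕ) + 1))).congr_of_eventuallyEq
          ((Complex.isOpen_slitPlane.eventually_mem hz).mono fun y hy => (hd y hy).deriv)
        convert! h2 using 1
        rw [(hd z hz).deriv]
        push_cast
        ring)
      (by simp [nicholsonIntegral_self]) hz
    have hone : w ^ (2 * 0 + 1) *
        deriv (fun z => Complex.Gamma ((0 : ℕ) + 1) * nicholsonIntegral 0 w z) w = 1 := by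
      rw [(hd w hw).deriv, nicholsonIntegral'_self]
      have hg : besselPhi 0 0 0 = 1 := by simpa using gamma_mul_besselPhi_zero 0
      simp [hg, hw0]
    rw [contourIntegral_integrand 0 z w γ hγ, hsol, hone]
    simp
  · refine ⟨-nicholsonSlope m / wronskian (m + 1) (normBesselJ (m + 1)) (normBesselJ' (m + 1))
      (normBesselY (m + 1)) (normBesselY' (m + 1)) 1,
      div_ne_zero (neg_ne_zero.2 (nicholsonSlope_ne_zero m)) hW,
      fun z hz w hw _ γ hγ R hR => ?_⟩
    have hw0 := Complex.slitPlane_ne_zero hw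
    have hz0 := Complex.slitPlane_ne_zero hz
    have hlim := fun j (hj : j ≤ m) => tendsto_opD_iterate_corrFun hz0 hR hj
    have hval := fun j (hj : j ≤ m) => (hlim j hj).limUnder_eq
    refine ⟨fun j hj => ?_, ?_⟩
    · rw [opDAtZero, hval j (by omega)]
      exact hlim j (by omega)
    · have hsol := eq_of_solvesBesselAt (α := m + 1) hw
        (fun z hz => (hasDerivAt_nicholsonDiff m hw0 hz).differentiableAt.differentiableWithinAt)
        (fun z hz hδ => solvesBesselAt_nicholsonDiff m hw0 hz hδ)
        (by simp [nicholsonDiff, nicholsonIntegral_self, corrSum_self]) hz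
      rw [deriv_nicholsonDiff_self m hw] at hsol
      rw [← hsol, contourIntegral_integrand (m + 1) z w γ hγ, nicholsonDiff, corrSum,
        Finset.mul_sum]
      congr 1
      refine Finset.sum_congr rfl fun j hj => ?_
      rw [opDAtZero, hval j (by have := Finset.mem_range.1 hj; omega)]
      field_simp
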